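/- Let $\mathcal{LE}$ be the class of logarithmico-exponential functions: real functions defined on some half-line $(c,\infty)$ by a finite combination of the symbols $+,-,\times,:,\log,\exp$ operating on the real variable $t$ and on real constants (two functions being identified if they agree for all large $t$). For real functions on a half-line write $a(t)\prec b(t)$ if $a(t)/b(t)\to 0$ as $t\to\infty$, and let $\mathcal{G}$ be the class of functions $a$, continuous on some half-line $(c,\infty)$, such that $t^{k+\varepsilon}\prec a(t)\prec t^{k+1}$ for some integer $k\ge 0$ and some $\varepsilon>0$. Let $a_1,\ldots,a_\ell\in\mathcal{LE}\cap\mathcal{G}$ have different growth rates, meaning that for $i\ne j$ the quotient $a_i(t)/a_j(t)$ converges to $0$, $+\infty$ or $-\infty$ as $t\to\infty$, and suppose that $a_i(t)\prec t$ for $i=1,\ldots,\ell$. Let $(X,\mathcal{X},\mu)$ be a probability space and let $T_1,\ldots,T_\ell\colon X\to X$ be invertible measure preserving transformations (bijections, measurable together with their inverses, that preserve $\mu$); they are not assumed to commute. Then for all $f_1,\ldots,f_\ell\in L^\infty(\mu)$ (real or complex valued) $$\lim_{N\to\infty}\frac1N\sum_{n=1}^N f_1\big(T_1^{[a_1(n)]}x\big)\cdots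 f_\ell\big(T_\ell^{[a_\ell(n)]}x\big)=\tilde f_1(x)\cdots\tilde f_\ell(x),\qquad \tilde f_i=\mathbb{E}\big(f_i\mid\mathcal{I}(T_i)\big),$$ where the convergence takes place in $L^2(\mu)$, $[t]$ denotes the integer part (the largest integer not exceeding $t$), and $\mathcal{I}(T_i)$ is the $\sigma$-algebra of $T_i$-invariant measurable sets. -/

import Mathlib

open Filter Topology MeasureTheory
open scoped ENNReal

/-- Logarithmico-exponential functions: the real functions that near `+∞` are given by a finite
combination of `+`, `-`, `×`, `:`, `log`, `exp` applied to the variable `t` and to real constants.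
Every intermediate expression has to be meaningful, as a real number, on some half-line: denominators
are eventually nonzero and arguments of `log` are eventually positive. Only the values on some
half-line `(c, ∞)` matter (`congr`). -/
inductive IsLogExp : (ℝ → ℝ) → Prop
  | var : IsLogExp (fun t => t)
  | const (c : ℝ) : IsLogExp (fun _ => c)
  | add {f g : ℝ → ℝ} : IsLogExp f → IsLogExp g → IsLogExp (fun t => f t + g t)
  | sub {f g : ℝ → ℝ} : IsLogExp f → IsLogExp g → IsLogExp (fun t => f t - g t)
  | mul {f g : ℝ → ℝ} : IsLogExp f → IsLogExp g → IsLogExp (fun t => f t * g t)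
  | div {f g : ℝ → ℝ} : IsLogExp f → IsLogExp g → (∀ᶠ t in atTop, g t ≠ 0) →
      IsLogExp (fun t => f t / g t)
  | log {f : ℝ → ℝ} : IsLogExp f → (∀ᶠ t in atTop, 0 < f t) → IsLogExp (fun t => Real.log (f t))
  | exp {f : ℝ → ℝ} : IsLogExp f → IsLogExp (fun t => Real.exp (f t))
  | congr {f g : ℝ → ℝ} : IsLogExp f → f =ᶠ[atTop] g → IsLogExp g

/-- `a(t) ≺ b(t)`, that is `a(t) / b(t) → 0` as `t → ∞` (in the little-o form, which agrees with
this when `b` is eventually nonzero and does not see division by zero). -/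
def GrowsSlower (a b : ℝ → ℝ) : Prop := a =o[atTop] b

/-- The class `𝒢` of functions that are continuous on some half-line and satisfy
`t ^ (k + ε) ≺ a(t) ≺ t ^ (k + 1)` for some integer `k ≥ 0` and some `ε > 0`. -/
def IsFractionalGrowth (a : ℝ → ℝ) : Prop :=
  (∃ c : ℝ, ContinuousOn a (Set.Ioi c)) ∧
    ∃ (k : ℕ) (ε : ℝ), 0 < ε ∧ GrowsSlower (fun t => t ^ ((k : ℝ) + ε)) a ∧
      GrowsSlower a (fun t => t ^ (k + 1))

/-- The quotient of any two of the functions converges to `0`, `+∞` or `-∞`. -/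
def HaveDifferentGrowthRates {ℓ : ℕ} (a : Fin ℓ → ℝ → ℝ) : Prop :=
  ∀ i j : Fin ℓ, i ≠ j →
    Tendsto (fun t => a i t / a j t) atTop (𝓝 0) ∨
      Tendsto (fun t => a i t / a j t) atTop atTop ∨
        Tendsto (fun t => a i t / a j t) atTop atBot

theorem eventually_atTop_eventually_nhds {p : ℝ → Prop} (h : ∀ᶠ t in atTop, p t) :
    ∀ᶠ t in atTop, ∀ᶠ s in 𝓝 t, p s := by
  obtain ⟨c, hc⟩ := eventually_atTop.1 h
  filter_upwards [eventually_gt_atTop c] with t ht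
  filter_upwards [lt_mem_nhds ht] with s hs using hc s hs.le

theorem eventually_hasDerivAt_congr {f g f' : ℝ → ℝ} (hfg : f =ᶠ[atTop] g)
    (hf : ∀ᶠ t in atTop, HasDerivAt f (f' t) t) : ∀ᶠ t in atTop, HasDerivAt g (f' t) t := by
  filter_upwards [eventually_atTop_eventually_nhds hfg, hf] with t h1 h2
  exact h2.congr_of_eventuallyEq (h1.mono fun _ h => h.symm)

/-- The function is eventually positive, eventually zero, or eventually negative. -/
def HasEventualSign (f : ℝ → ℝ) : Prop :=
  (∀ᶠ t in atTop, 0 < f t) ∨ (∀ᶠ t in atTop, f t = 0) ∨ (∀ᶠ t in atTop, f t < 0)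

namespace HasEventualSign

theorem congr {f g : ℝ → ℝ} (hf : HasEventualSign f) (h : f =ᶠ[atTop] g) :
    HasEventualSign g := by
  rcases hf with hf | hf | hf
  · left; filter_upwards [hf, h] with t h1 h2; rwa [← h2]
  · right; left; filter_upwards [hf, h] with t h1 h2; rwa [← h2]
  · right; right; filter_upwards [hf, h] with t h1 h2; rwa [← h2]

theorem mul {f g : ℝ → ℝ} (hf : HasEventualSign f) (hg : HasEventualSign g) :
    HasEventualSign (f * g) := by
  rcases hf with hf | hf | hf
  · rcases hg with hg | hg | hg
    · left; filter_upwards [hf, hg] with t h1 h2 using mul_pos h1 h2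
    · right; left; filter_upwards [hg] with t h2; simp [h2]
    · right; right; filter_upwards [hf, hg] with t h1 h2 using mul_neg_of_pos_of_neg h1 h2
  · right; left; filter_upwards [hf] with t h2; simp [h2]
  · rcases hg with hg | hg | hg
    · right; right; filter_upwards [hf, hg] with t h1 h2 using mul_neg_of_neg_of_pos h1 h2
    · right; left; filter_upwards [hg] with t h2; simp [h2]
    · left; filter_upwards [hf, hg] with t h1 h2 using mul_pos_of_neg_of_neg h1 h2

theorem neg {f : ℝ → ℝ} (hf : HasEventualSign f) : HasEventualSign (-f) := by
  rcases hf with hf | hf | hf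
  · right; right; filter_upwards [hf] with t h; simpa using h
  · right; left; filter_upwards [hf] with t h; simpa using h
  · left; filter_upwards [hf] with t h; simpa using h

theorem inv {f : ℝ → ℝ} (hf : HasEventualSign f) : HasEventualSign f⁻¹ := by
  rcases hf with hf | hf | hf
  · left; filter_upwards [hf] with t h; simpa using h
  · right; left; filter_upwards [hf] with t h; simpa using h
  · right; right; filter_upwards [hf] with t h; simpa using h

theorem zero_or_ne {f : ℝ → ℝ} (hf : HasEventualSign f) :
    (∀ᶠ t in atTop, f t = 0) ∨ (∀ᶠ t in atTop, f t ≠ 0) := by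
  rcases hf with hf | hf | hf
  · exact .inr (hf.mono fun t h => h.ne')
  · exact .inl hf
  · exact .inr (hf.mono fun t h => h.ne)

end HasEventualSign

theorem exists_strictMonoOn_Ici_of_deriv_pos {f f' : ℝ → ℝ}
    (hf : ∀ᶠ t in atTop, HasDerivAt f (f' t) t) (hpos : ∀ᶠ t in atTop, 0 < f' t) :
    ∃ c, StrictMonoOn f (Set.Ici c) := by
  obtain ⟨c, hc⟩ := eventually_atTop.1 (hf.and hpos)
  refine ⟨c, strictMonoOn_of_deriv_pos (convex_Ici c)
    (fun t ht => (hc t ht).1.continuousAt.continuousWithinAt) fun t ht => ?_⟩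
  rw [interior_Ici] at ht
  rw [(hc t ht.le).1.deriv]
  exact (hc t ht.le).2

theorem HasEventualSign.of_strictMonoOn {f : ℝ → ℝ} {c : ℝ} (h : StrictMonoOn f (Set.Ici c)) :
    HasEventualSign f := by
  by_cases h0 : ∃ t ≥ c, 0 ≤ f t
  · obtain ⟨t, ht, hft⟩ := h0
    left
    filter_upwards [eventually_gt_atTop t] with s hs
    exact hft.trans_lt (h ht (ht.trans hs.le) hs)
  · push Not at h0
    right; right
    filter_upwards [eventually_ge_atTop c] with s hs using h0 s hs

theorem HasEventualSign.of_hasDerivAt {f f' : ℝ → ℝ}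
    (hf : ∀ᶠ t in atTop, HasDerivAt f (f' t) t) (hs : HasEventualSign f') :
    HasEventualSign f := by
  rcases hs with hs | hs | hs
  · obtain ⟨c, hc⟩ := exists_strictMonoOn_Ici_of_deriv_pos hf hs
    exact .of_strictMonoOn hc
  · obtain ⟨c, hc⟩ := eventually_atTop.1 (hf.and hs)
    have hconst : ∀ t ≥ c, f t = f c := by
      intro t ht
      refine constant_of_has_deriv_right_zero
        (fun x hx => (hc x hx.1).1.continuousAt.continuousWithinAt) (fun x hx => ?_) t
        ⟨ht, le_rfl⟩
      have := (hc x hx.1).1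
      rw [(hc x hx.1).2] at this
      exact this.hasDerivWithinAt
    have hev : (fun _ => f c) =ᶠ[atTop] f := by
      filter_upwards [eventually_ge_atTop c] with t ht using (hconst t ht).symm
    refine HasEventualSign.congr ?_ hev
    rcases lt_trichotomy (f c) 0 with h | h | h
    · exact .inr (.inr (.of_forall fun _ => h))
    · exact .inr (.inl (.of_forall fun _ => h))
    · exact .inl (.of_forall fun _ => h)
  · have hf' : ∀ᶠ t in atTop, HasDerivAt (-f) ((-f') t) t := hf.mono fun t h => h.neg
    obtain ⟨c, hc⟩ := exists_strictMonoOn_Ici_of_deriv_pos hf'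
      (hs.mono fun t h => by simpa using h)
    simpa using (HasEventualSign.of_strictMonoOn hc).neg

/-- A Hardy field, as a ring of functions closed under eventual equality; the value of an inverse
where it is not defined is irrelevant. -/
structure IsHardyField (H : Subring (ℝ → ℝ)) : Prop where
  const_mem : ∀ c : ℝ, (fun _ => c) ∈ H
  inv_mem : ∀ {f : ℝ → ℝ}, f ∈ H → f⁻¹ ∈ H
  congr_mem : ∀ {f g : ℝ → ℝ}, f ∈ H → f =ᶠ[atTop] g → g ∈ H
  exists_deriv : ∀ {f : ℝ → ℝ}, f ∈ H → ∃ f' ∈ H, ∀ᶠ t in atTop, HasDerivAt f (f' t) t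
  sign : ∀ {f : ℝ → ℝ}, f ∈ H → HasEventualSign f

section Extension

variable {H : Subring (ℝ → ℝ)} {y : ℝ → ℝ}

/-- The `H`-linear combinations of the powers of `y` of exponent at most `n`. -/
def polySpan (H : Subring (ℝ → ℝ)) (y : ℝ → ℝ) : ℕ → Submodule H (ℝ → ℝ)
  | 0 => Submodule.span H {1}
  | n + 1 => Submodule.span H {y ^ (n + 1)} ⊔ polySpan H y n

theorem mem_polySpan_zero {f : ℝ → ℝ} : f ∈ polySpan H y 0 ↔ f ∈ H := by
  rw [polySpan, Submodule.mem_span_singleton]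
  constructor
  · rintro ⟨c, rfl⟩
    simp [Subring.smul_def]
  · intro hf
    exact ⟨⟨f, hf⟩, by simp [Subring.smul_def]⟩

theorem mem_polySpan_succ {n : ℕ} {f : ℝ → ℝ} :
    f ∈ polySpan H y (n + 1) ↔ ∃ c ∈ H, ∃ r ∈ polySpan H y n, f = c * y ^ (n + 1) + r := by
  rw [polySpan, Submodule.mem_sup]
  constructor
  · rintro ⟨_, h1, r, hr, rfl⟩
    obtain ⟨c, rfl⟩ := Submodule.mem_span_singleton.1 h1
    exact ⟨c, c.2, r, hr, by simp [Subring.smul_def]⟩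
  · rintro ⟨c, hc, r, hr, rfl⟩
    exact ⟨_, Submodule.mem_span_singleton.2 ⟨⟨c, hc⟩, rfl⟩, r, hr, by simp [Subring.smul_def]⟩

theorem polySpan_le_succ (n : ℕ) : polySpan H y n ≤ polySpan H y (n + 1) := le_sup_right

theorem mul_mem_polySpan {n : ℕ} {c f : ℝ → ℝ} (hc : c ∈ H) (hf : f ∈ polySpan H y n) :
    c * f ∈ polySpan H y n := by
  simpa [Subring.smul_def] using (polySpan H y n).smul_mem ⟨c, hc⟩ hf

theorem mul_pow_mem_polySpan {n : ℕ} {c : ℝ → ℝ} (hc : c ∈ H) : c * y ^ n ∈ polySpan H y n := by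
  cases n with
  | zero => simpa [mem_polySpan_zero] using hc
  | succ n => exact mem_polySpan_succ.2 ⟨c, hc, 0, zero_mem _, by simp⟩

theorem exists_mem_polySpan_of_mem_adjoin {f : ℝ → ℝ} (hf : f ∈ Algebra.adjoin H {y}) :
    ∃ n, f ∈ polySpan H y n := by
  rw [Algebra.adjoin_singleton_eq_range_aeval] at hf
  obtain ⟨p, rfl⟩ := hf
  refine ⟨p.natDegree, ?_⟩
  have key : ∀ (c : ℕ → H) n, ∑ i ∈ Finset.range (n + 1), c i • y ^ i ∈ polySpan H y n := by
    intro c n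
    induction n with
    | zero => simp [mem_polySpan_zero, Subring.smul_def]
    | succ n ih =>
      rw [Finset.sum_range_succ]
      exact add_mem (polySpan_le_succ n ih) (mul_pow_mem_polySpan (c (n + 1)).2)
  have := key p.coeff p.natDegree
  rwa [← Polynomial.aeval_eq_sum_range] at this

theorem exists_polySpan_deriv_of_mul_pow (hH : IsHardyField H)
    (hy : ∀ n, ∀ c ∈ H, ∃ g ∈ polySpan H y n,
      ∀ᶠ t in atTop, HasDerivAt (c * y ^ n) (g t) t) (n : ℕ) {f : ℝ → ℝ}
    (hf : f ∈ polySpan H y n) :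
    ∃ g ∈ polySpan H y n, ∀ᶠ t in atTop, HasDerivAt f (g t) t := by
  induction n generalizing f with
  | zero =>
    obtain ⟨g, hg, h⟩ := hH.exists_deriv (mem_polySpan_zero.1 hf)
    exact ⟨g, mem_polySpan_zero.2 hg, h⟩
  | succ n ih =>
    obtain ⟨c, hc, r, hr, rfl⟩ := mem_polySpan_succ.1 hf
    obtain ⟨g, hg, h⟩ := hy (n + 1) c hc
    obtain ⟨s, hs, h'⟩ := ih hr
    exact ⟨g + s, add_mem hg (polySpan_le_succ n hs), by
      filter_upwards [h, h'] with t h1 h2 using h1.add h2⟩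

/-- The quotients of polynomials in `y` over `H`. -/
def adjoinField (H : Subring (ℝ → ℝ)) (y : ℝ → ℝ) : Subring (ℝ → ℝ) where
  carrier := {f | ∃ p ∈ Algebra.adjoin H {y}, ∃ q ∈ Algebra.adjoin H {y},
    (∀ᶠ t in atTop, q t ≠ 0) ∧ f =ᶠ[atTop] fun t => p t / q t}
  zero_mem' := ⟨0, zero_mem _, 1, one_mem _, by simp, by simp; rfl⟩
  one_mem' := ⟨1, one_mem _, 1, one_mem _, by simp, by simp; rfl⟩
  add_mem' := by
    rintro f g ⟨p, hp, q, hq, hq0, hf⟩ ⟨p', hp', q', hq', hq0', hg⟩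
    refine ⟨p * q' + q * p', add_mem (mul_mem hp hq') (mul_mem hq hp'), q * q', mul_mem hq hq',
      ?_, ?_⟩
    · filter_upwards [hq0, hq0'] with t h h' using mul_ne_zero h h'
    · filter_upwards [hq0, hq0', hf, hg] with t h h' h1 h2
      simp [h1, h2, div_add_div _ _ h h']
  mul_mem' := by
    rintro f g ⟨p, hp, q, hq, hq0, hf⟩ ⟨p', hp', q', hq', hq0', hg⟩
    refine ⟨p * p', mul_mem hp hp', q * q', mul_mem hq hq', ?_, ?_⟩
    · filter_upwards [hq0, hq0'] with t h h' using mul_ne_zero h h'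
    · filter_upwards [hq0, hq0', hf, hg] with t h h' h1 h2
      simp [h1, h2, div_mul_div_comm]
  neg_mem' := by
    rintro f ⟨p, hp, q, hq, hq0, hf⟩
    refine ⟨-p, neg_mem hp, q, hq, hq0, ?_⟩
    filter_upwards [hf] with t h
    simp [h, neg_div]

theorem le_adjoinField : H ≤ adjoinField H y := fun f hf =>
  ⟨f, (Algebra.adjoin H {y}).algebraMap_mem ⟨f, hf⟩, 1, one_mem _, by simp, by simp⟩

theorem mem_adjoinField : y ∈ adjoinField H y :=
  ⟨y, Algebra.subset_adjoin rfl, 1, one_mem _, by simp, by simp⟩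

theorem polySpan_le_adjoin (n : ℕ) {f : ℝ → ℝ} (hf : f ∈ polySpan H y n) :
    f ∈ Algebra.adjoin H {y} := by
  induction n generalizing f with
  | zero => exact (Algebra.adjoin H {y}).algebraMap_mem ⟨f, mem_polySpan_zero.1 hf⟩
  | succ n ih =>
    obtain ⟨c, hc, r, hr, rfl⟩ := mem_polySpan_succ.1 hf
    have hc' : c ∈ Algebra.adjoin H {y} := (Algebra.adjoin H {y}).algebraMap_mem ⟨c, hc⟩
    have hy : y ∈ Algebra.adjoin H {y} := Algebra.subset_adjoin rfl
    exact add_mem (mul_mem hc' (pow_mem hy (n + 1))) (ih hr)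

theorem isHardyField_adjoinField (hH : IsHardyField H)
    (hsign : ∀ n, ∀ f ∈ polySpan H y n, HasEventualSign f)
    (hderiv : ∀ n, ∀ f ∈ polySpan H y n,
      ∃ g ∈ polySpan H y n, ∀ᶠ t in atTop, HasDerivAt f (g t) t) :
    IsHardyField (adjoinField H y) where
  const_mem c := le_adjoinField (hH.const_mem c)
  inv_mem := by
    rintro f ⟨p, hp, q, hq, hq0, hf⟩
    obtain ⟨n, hpn⟩ := exists_mem_polySpan_of_mem_adjoin hp
    rcases (hsign n p hpn).zero_or_ne with h0 | h0
    · refine ⟨0, zero_mem _, 1, one_mem _, by simp, ?_⟩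
      filter_upwards [hf, h0] with t h1 h2
      simp [h1, h2]
    · refine ⟨q, hq, p, hp, h0, ?_⟩
      filter_upwards [hf] with t h1
      simp [h1]
  congr_mem := by
    rintro f g ⟨p, hp, q, hq, hq0, hf⟩ hfg
    exact ⟨p, hp, q, hq, hq0, hfg.symm.trans hf⟩
  exists_deriv := by
    rintro f ⟨p, hp, q, hq, hq0, hf⟩
    obtain ⟨n, hpn⟩ := exists_mem_polySpan_of_mem_adjoin hp
    obtain ⟨m, hqm⟩ := exists_mem_polySpan_of_mem_adjoin hq
    obtain ⟨p', hp', hpd⟩ := hderiv n p hpn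
    obtain ⟨q', hq', hqd⟩ := hderiv m q hqm
    refine ⟨fun t => (p' t * q t - p t * q' t) / q t ^ 2,
      ⟨p' * q - p * q', sub_mem (mul_mem (polySpan_le_adjoin n hp') hq)
        (mul_mem hp (polySpan_le_adjoin m hq')), q ^ 2, pow_mem hq 2, ?_, .rfl⟩, ?_⟩
    · filter_upwards [hq0] with t h using pow_ne_zero 2 h
    · refine eventually_hasDerivAt_congr hf.symm ?_
      filter_upwards [hpd, hqd, hq0] with t h1 h2 h3 using h1.div h2 h3
  sign := by
    rintro f ⟨p, hp, q, hq, hq0, hf⟩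
    obtain ⟨n, hpn⟩ := exists_mem_polySpan_of_mem_adjoin hp
    obtain ⟨m, hqm⟩ := exists_mem_polySpan_of_mem_adjoin hq
    refine ((hsign n p hpn).mul (hsign m q hqm).inv).congr ?_
    filter_upwards [hf] with t h
    simp [h, div_eq_mul_inv]

/-- Adjoining an antiderivative of an element of a Hardy field. -/
theorem IsHardyField.exists_adjoin_antideriv (hH : IsHardyField H) {y' : ℝ → ℝ} (hy' : y' ∈ H)
    (hy : ∀ᶠ t in atTop, HasDerivAt y (y' t) t) :
    ∃ H' : Subring (ℝ → ℝ), IsHardyField H' ∧ H ≤ H' ∧ y ∈ H' := by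
  have hpow : ∀ n : ℕ, ∀ᶠ t in atTop, HasDerivAt (y ^ (n + 1)) ((n + 1 : ℝ) * y t ^ n * y' t) t := by
    intro n
    filter_upwards [hy] with t h
    simpa using h.pow (n + 1)
  have hnat : ∀ n : ℕ, (fun t => (n + 1 : ℝ) * y' t) ∈ H := fun n =>
    mul_mem (hH.const_mem (n + 1)) hy'
  have hpowmem : ∀ n : ℕ, (fun t => (n + 1 : ℝ) * y t ^ n * y' t) ∈ polySpan H y n := by
    intro n
    convert mul_pow_mem_polySpan (n := n) (hnat n) using 1
    ext t
    simp only [Pi.mul_apply, Pi.pow_apply]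
    ring
  have hderiv : ∀ n, ∀ f ∈ polySpan H y n,
      ∃ g ∈ polySpan H y n, ∀ᶠ t in atTop, HasDerivAt f (g t) t := by
    refine fun n f hf => exists_polySpan_deriv_of_mul_pow hH ?_ n hf
    intro n c hc
    obtain ⟨c', hc', hcd⟩ := hH.exists_deriv hc
    cases n with
    | zero => exact ⟨c', mem_polySpan_zero.2 hc', by simpa using hcd⟩
    | succ n =>
      refine ⟨_, add_mem (mul_pow_mem_polySpan (n := n + 1) hc')
        (polySpan_le_succ n (mul_mem_polySpan hc (hpowmem n))), ?_⟩
      filter_upwards [hcd, hpow n] with t h1 h2 using h1.mul h2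
  have hsign : ∀ n, ∀ f ∈ polySpan H y n, HasEventualSign f := by
    intro n
    induction n with
    | zero => exact fun f hf => hH.sign (mem_polySpan_zero.1 hf)
    | succ n ih =>
      intro f hf
      obtain ⟨c, hc, r, hr, rfl⟩ := mem_polySpan_succ.1 hf
      rcases (hH.sign hc).zero_or_ne with h0 | h0
      · refine (ih r hr).congr ?_
        filter_upwards [h0] with t h
        simp [h]
      obtain ⟨s, hs, hd⟩ := hderiv n _ (mul_mem_polySpan (hH.inv_mem hc) hr)
      have hmain : HasEventualSign (y ^ (n + 1) + c⁻¹ * r) := by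
        refine .of_hasDerivAt ?_ (ih _ (add_mem (hpowmem n) hs))
        filter_upwards [hpow n, hd] with t h1 h2 using h1.add h2
      refine ((hH.sign hc).mul hmain).congr ?_
      filter_upwards [h0] with t h
      simp only [Pi.mul_apply, Pi.add_apply, Pi.inv_apply, Pi.pow_apply]
      field_simp
  exact ⟨_, isHardyField_adjoinField hH hsign hderiv, le_adjoinField, mem_adjoinField⟩

/-- Adjoining the exponential of an element of a Hardy field. -/
theorem IsHardyField.exists_adjoin_exp (hH : IsHardyField H) {u : ℝ → ℝ} (hu : u ∈ H) :
    ∃ H' : Subring (ℝ → ℝ), IsHardyField H' ∧ H ≤ H' ∧ (fun t => Real.exp (u t)) ∈ H' := by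
  obtain ⟨u', hu', hud⟩ := hH.exists_deriv hu
  set y : ℝ → ℝ := fun t => Real.exp (u t) with hy
  have hpow : ∀ n : ℕ, ∀ᶠ t in atTop, HasDerivAt (y ^ n) (n * u' t * y t ^ n) t := by
    intro n
    filter_upwards [hud] with t h
    refine (h.exp.pow n).congr_deriv ?_
    rcases n with _ | n
    · simp
    · simp only [hy, Nat.add_sub_cancel]
      push_cast
      ring
  have hnat : ∀ n : ℕ, (fun t => (n : ℝ) * u' t) ∈ H := fun n =>
    mul_mem (hH.const_mem n) hu'
  have hderiv : ∀ n, ∀ f ∈ polySpan H y n,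
      ∃ g ∈ polySpan H y n, ∀ᶠ t in atTop, HasDerivAt f (g t) t := by
    refine fun n f hf => exists_polySpan_deriv_of_mul_pow hH ?_ n hf
    intro n c hc
    obtain ⟨c', hc', hcd⟩ := hH.exists_deriv hc
    refine ⟨_, mul_pow_mem_polySpan (n := n) (add_mem hc' (mul_mem hc (hnat n))), ?_⟩
    filter_upwards [hcd, hpow n] with t h1 h2
    refine (h1.mul h2).congr_deriv ?_
    simp only [Pi.mul_apply, Pi.add_apply, Pi.pow_apply]
    ring
  have hypos : ∀ t, 0 < y t := fun t => Real.exp_pos _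
  have hysign : ∀ n : ℕ, HasEventualSign (y ^ n) := fun n =>
    .inl (.of_forall fun t => pow_pos (hypos t) n)
  have hsign : ∀ n, ∀ f ∈ polySpan H y n, HasEventualSign f := by
    intro n
    induction n with
    | zero => exact fun f hf => hH.sign (mem_polySpan_zero.1 hf)
    | succ n ih =>
      intro f hf
      obtain ⟨c, hc, r, hr, rfl⟩ := mem_polySpan_succ.1 hf
      rcases (hH.sign hc).zero_or_ne with h0 | h0
      · refine (ih r hr).congr ?_
        filter_upwards [h0] with t h
        simp [h]
      have hr' := mul_mem_polySpan (hH.inv_mem hc) hr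
      obtain ⟨s, hs, hd⟩ := hderiv n _ hr'
      have hmain : HasEventualSign (1 + c⁻¹ * r * (y ^ (n + 1))⁻¹) := by
        refine .of_hasDerivAt ?_ ((ih _ (sub_mem hs (mul_mem_polySpan (hnat (n + 1)) hr'))).mul
          (hysign (n + 1)).inv)
        filter_upwards [hpow (n + 1), hd] with t h1 h2
        have hne : (y ^ (n + 1)) t ≠ 0 := (pow_pos (hypos t) _).ne'
        refine ((hasDerivAt_const t (1 : ℝ)).add (h2.mul (h1.inv hne))).congr_deriv ?_
        have := (hypos t).ne'
        simp only [Pi.mul_apply, Pi.sub_apply, Pi.inv_apply, Pi.pow_apply]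
        field_simp
        ring
      refine (((hH.sign hc).mul (hysign (n + 1))).mul hmain).congr ?_
      filter_upwards [h0] with t h
      have := (hypos t).ne'
      simp only [Pi.mul_apply, Pi.add_apply, Pi.inv_apply, Pi.pow_apply, Pi.one_apply]
      field_simp
  exact ⟨_, isHardyField_adjoinField hH hsign hderiv, le_adjoinField, mem_adjoinField⟩

end Extension

/-- The eventually constant functions. -/
def eventuallyConst : Subring (ℝ → ℝ) where
  carrier := {f | ∃ c : ℝ, ∀ᶠ t in atTop, f t = c}
  zero_mem' := ⟨0, by simp⟩
  one_mem' := ⟨1, by simp⟩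
  add_mem' := by
    rintro f g ⟨c, hc⟩ ⟨d, hd⟩
    exact ⟨c + d, by filter_upwards [hc, hd] with t h1 h2; simp [h1, h2]⟩
  mul_mem' := by
    rintro f g ⟨c, hc⟩ ⟨d, hd⟩
    exact ⟨c * d, by filter_upwards [hc, hd] with t h1 h2; simp [h1, h2]⟩
  neg_mem' := by
    rintro f ⟨c, hc⟩
    exact ⟨-c, by filter_upwards [hc] with t h1; simp [h1]⟩

theorem isHardyField_eventuallyConst : IsHardyField eventuallyConst where
  const_mem c := ⟨c, by simp⟩
  inv_mem := by
    rintro f ⟨c, hc⟩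
    exact ⟨c⁻¹, by filter_upwards [hc] with t h1; simp [h1]⟩
  congr_mem := by
    rintro f g ⟨c, hc⟩ h
    exact ⟨c, by filter_upwards [hc, h] with t h1 h2; rw [← h2, h1]⟩
  exists_deriv := by
    rintro f ⟨c, hc⟩
    refine ⟨0, zero_mem _, eventually_hasDerivAt_congr (f := fun _ => c) ?_ ?_⟩
    · filter_upwards [hc] with t h using h.symm
    · exact .of_forall fun t => hasDerivAt_const t c
  sign := by
    rintro f ⟨c, hc⟩
    rcases lt_trichotomy c 0 with h | h | h
    · exact .inr (.inr (hc.mono fun t ht => by rwa [ht]))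
    · exact .inr (.inl (hc.mono fun t ht => by rwa [ht]))
    · exact .inl (hc.mono fun t ht => by rwa [ht])

theorem IsLogExp.exists_isHardyField_ge {f : ℝ → ℝ} (hf : IsLogExp f) {H : Subring (ℝ → ℝ)}
    (hH : IsHardyField H) : ∃ H' : Subring (ℝ → ℝ), IsHardyField H' ∧ H ≤ H' ∧ f ∈ H' := by
  induction hf generalizing H with
  | var =>
    exact hH.exists_adjoin_antideriv (y' := 1) (one_mem H) (.of_forall fun t => hasDerivAt_id t)
  | const c => exact ⟨H, hH, le_rfl, hH.const_mem c⟩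
  | add _ _ ihf ihg =>
    obtain ⟨H₁, h₁, hle₁, hf⟩ := ihf hH
    obtain ⟨H₂, h₂, hle₂, hg⟩ := ihg h₁
    exact ⟨H₂, h₂, hle₁.trans hle₂, add_mem (hle₂ hf) hg⟩
  | sub _ _ ihf ihg =>
    obtain ⟨H₁, h₁, hle₁, hf⟩ := ihf hH
    obtain ⟨H₂, h₂, hle₂, hg⟩ := ihg h₁
    exact ⟨H₂, h₂, hle₁.trans hle₂, sub_mem (hle₂ hf) hg⟩
  | mul _ _ ihf ihg =>
    obtain ⟨H₁, h₁, hle₁, hf⟩ := ihf hH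
    obtain ⟨H₂, h₂, hle₂, hg⟩ := ihg h₁
    exact ⟨H₂, h₂, hle₁.trans hle₂, mul_mem (hle₂ hf) hg⟩
  | div _ _ _ ihf ihg =>
    obtain ⟨H₁, h₁, hle₁, hf⟩ := ihf hH
    obtain ⟨H₂, h₂, hle₂, hg⟩ := ihg h₁
    refine ⟨H₂, h₂, hle₁.trans hle₂, ?_⟩
    convert mul_mem (hle₂ hf) (h₂.inv_mem hg) using 1
    ext t
    exact div_eq_mul_inv _ _
  | log _ hpos ih =>
    obtain ⟨H₁, h₁, hle₁, hf⟩ := ih hH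
    obtain ⟨f', hf', hd⟩ := h₁.exists_deriv hf
    obtain ⟨H₂, h₂, hle₂, hg⟩ := h₁.exists_adjoin_antideriv (mul_mem hf' (h₁.inv_mem hf)) (by
      filter_upwards [hpos, hd] with t h1 h2
      exact h2.log h1.ne')
    exact ⟨H₂, h₂, hle₁.trans hle₂, hg⟩
  | exp _ ih =>
    obtain ⟨H₁, h₁, hle₁, hf⟩ := ih hH
    obtain ⟨H₂, h₂, hle₂, hg⟩ := h₁.exists_adjoin_exp hf
    exact ⟨H₂, h₂, hle₁.trans hle₂, hg⟩
  | congr _ h ih =>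
    obtain ⟨H₁, h₁, hle₁, hf⟩ := ih hH
    exact ⟨H₁, h₁, hle₁, h₁.congr_mem hf h⟩

theorem IsLogExp.exists_isHardyField {f : ℝ → ℝ} (hf : IsLogExp f) :
    ∃ H : Subring (ℝ → ℝ), IsHardyField H ∧ (fun t => t) ∈ H ∧ f ∈ H := by
  obtain ⟨H₁, h₁, -, ht⟩ := IsLogExp.var.exists_isHardyField_ge isHardyField_eventuallyConst
  obtain ⟨H₂, h₂, hle, hf⟩ := hf.exists_isHardyField_ge h₁
  exact ⟨H₂, h₂, hle ht, hf⟩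

/-- An increasing concave sequence between a power `n ^ ε` and `n`, with its increments bounded
below accordingly. -/
structure IsSublinearConcave (u : ℕ → ℝ) : Prop where
  tendsto_atTop : Tendsto u atTop atTop
  tendsto_div : Tendsto (fun n => u n / n) atTop (𝓝 0)
  exists_bounds : ∃ n₀ : ℕ, ∃ ε > 0, ∀ n ≥ n₀, 0 < u n ∧ u n < u (n + 1) ∧
    u (n + 2) - u (n + 1) ≤ u (n + 1) - u n ∧ ε * u n ≤ (n + 1) * (u (n + 1) - u n)

theorem antitoneOn_Ici_of_hasDerivAt {f f' : ℝ → ℝ} {c : ℝ}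
    (hf : ∀ t ≥ c, HasDerivAt f (f' t) t) (h : ∀ t ≥ c, f' t ≤ 0) : AntitoneOn f (Set.Ici c) := by
  refine antitoneOn_of_deriv_nonpos (convex_Ici c)
    (fun t ht => (hf t ht).continuousAt.continuousWithinAt) (fun t ht => ?_) fun t ht => ?_ <;>
  rw [interior_Ici] at ht
  · exact (hf t ht.le).differentiableAt.differentiableWithinAt
  · rw [(hf t ht.le).deriv]
    exact h t ht.le

theorem IsHardyField.exists_regular {H : Subring (ℝ → ℝ)} (hH : IsHardyField H)
    (hid : (fun t => t) ∈ H) {u : ℝ → ℝ} (hu : u ∈ H) {ε : ℝ} (hε : 0 < ε)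
    (hpos : ∀ᶠ t in atTop, 0 < u t) (hlow : (fun t => t ^ ε) =o[atTop] u)
    (hup : u =o[atTop] fun t => t) :
    Tendsto u atTop atTop ∧ ∃ u' : ℝ → ℝ, ∃ c > 0, AntitoneOn u' (Set.Ici c) ∧
      ∀ t ≥ c, 0 < u t ∧ HasDerivAt u (u' t) t ∧ 0 < u' t ∧ ε * u t ≤ t * u' t := by
  have hu_top : Tendsto u atTop atTop := by
    refine tendsto_atTop_mono' _ ?_ (tendsto_rpow_atTop hε)
    filter_upwards [hlow.bound one_pos, hpos, eventually_ge_atTop 0] with t h1 h2 h3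
    rw [Real.norm_of_nonneg (Real.rpow_nonneg h3 _), Real.norm_of_nonneg h2.le, one_mul] at h1
    exact h1
  refine ⟨hu_top, ?_⟩
  obtain ⟨u', hu', hd⟩ := hH.exists_deriv hu
  obtain ⟨u'', hu'', hd'⟩ := hH.exists_deriv hu'
  have hpos' : ∀ᶠ t in atTop, 0 < u' t := by
    by_contra hcon
    have hle : ∀ᶠ t in atTop, u' t ≤ 0 := by
      rcases hH.sign hu' with h | h | h
      · exact absurd h hcon
      · exact h.mono fun t h => h.le
      · exact h.mono fun t h => h.le
    obtain ⟨c, hc⟩ := eventually_atTop.1 (hd.and hle)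
    have hanti := antitoneOn_Ici_of_hasDerivAt (fun t ht => (hc t ht).1) fun t ht => (hc t ht).2
    obtain ⟨t, ht1, ht2⟩ := ((hu_top.eventually_gt_atTop (u c)).and (eventually_ge_atTop c)).exists
    exact absurd (hanti Set.self_mem_Ici ht2 ht2) (not_le.2 ht1)
  have hconc : ∀ᶠ t in atTop, u'' t ≤ 0 := by
    rcases hH.sign hu'' with h | h | h
    · exfalso
      obtain ⟨c, hc⟩ := eventually_atTop.1 (hd.and (hd'.and (h.and hpos')))
      have hmono : MonotoneOn u' (Set.Ici c) := by
        have := antitoneOn_Ici_of_hasDerivAt (f := -u') (f' := -u'') (c := c)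
          (fun t ht => (hc t ht).2.1.neg) (fun t ht => by simpa using (hc t ht).2.2.1.le)
        exact fun x hx y hy hxy => by simpa using this hx hy hxy
      have hlin : AntitoneOn (fun t => u' c * t - u t) (Set.Ici c) := by
        refine antitoneOn_Ici_of_hasDerivAt (f' := fun t => u' c * 1 - u' t)
          (fun t ht => ((hasDerivAt_id t).const_mul _).sub (hc t ht).1) fun t ht => ?_
        have := hmono Set.self_mem_Ici ht ht
        linarith
      have hc0 : 0 < u' c := (hc c le_rfl).2.2.2
      have hbig : ∀ᶠ t in atTop, u' c * c - u c < u' c / 2 * t :=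
        (tendsto_id.const_mul_atTop (half_pos hc0)).eventually_gt_atTop _
      obtain ⟨t, h1, h2, h3, h4, h5⟩ := ((hup.bound (half_pos hc0)).and ((eventually_ge_atTop c).and
        (hpos.and ((eventually_ge_atTop 0).and hbig)))).exists
      rw [Real.norm_of_nonneg h3.le, Real.norm_of_nonneg h4] at h1
      have := hlin Set.self_mem_Ici h2 h2
      simp only at this
      linarith
    · exact h.mono fun t h => h.le
    · exact h.mono fun t h => h.le
  have hlog : ∀ᶠ t in atTop, ε * u t ≤ t * u' t := by
    by_contra hcon
    have hmem : (fun t => t * u' t - ε * u t) ∈ H :=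
      sub_mem (mul_mem hid hu') (mul_mem (hH.const_mem ε) hu)
    have hlt : ∀ᶠ t in atTop, t * u' t - ε * u t < 0 := by
      rcases hH.sign hmem with h | h | h
      · exact absurd (h.mono fun t h => by linarith) hcon
      · exact absurd (h.mono fun t h => by linarith) hcon
      · exact h
    obtain ⟨c, hc⟩ := eventually_atTop.1
      (hd.and (hlt.and (hpos.and (eventually_gt_atTop (0 : ℝ)))))
    have hanti : AntitoneOn (fun t => Real.log (u t) - ε * Real.log t) (Set.Ici c) := by
      refine antitoneOn_Ici_of_hasDerivAt (f' := fun t => u' t / u t - ε * t⁻¹)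
        (fun t ht => ((hc t ht).1.log (hc t ht).2.2.1.ne').sub
          ((Real.hasDerivAt_log (hc t ht).2.2.2.ne').const_mul ε)) fun t ht => ?_
      obtain ⟨-, h1, h2, h3⟩ := hc t ht
      have : u' t / u t - ε * t⁻¹ = (t * u' t - ε * u t) / (u t * t) := by field_simp
      rw [this]
      exact div_nonpos_of_nonpos_of_nonneg h1.le (mul_pos h2 h3).le
    set K := Real.log (u c) - ε * Real.log c
    obtain ⟨t, h1, h2⟩ := ((hlow.bound (half_pos (Real.exp_pos (-K)))).and
      (eventually_ge_atTop c)).exists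
    obtain ⟨-, -, h3, h4⟩ := hc t h2
    have hK := hanti Set.self_mem_Ici h2 h2
    simp only at hK
    rw [Real.norm_of_nonneg (Real.rpow_nonneg h4.le _), Real.norm_of_nonneg h3.le] at h1
    have h5 : u t ≤ Real.exp K * t ^ ε := by
      rw [Real.rpow_def_of_pos h4, ← Real.exp_add, ← Real.log_le_iff_le_exp h3]
      linarith
    have h6 : Real.exp (-K) / 2 * u t ≤ t ^ ε / 2 := by
      calc Real.exp (-K) / 2 * u t ≤ Real.exp (-K) / 2 * (Real.exp K * t ^ ε) := by gcongr
        _ = (Real.exp (-K) * Real.exp K) * t ^ ε / 2 := by ring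
        _ = t ^ ε / 2 := by rw [← Real.exp_add]; simp
    have := Real.rpow_pos_of_pos h4 ε
    linarith
  obtain ⟨c, hc⟩ := eventually_atTop.1
    (hd.and (hd'.and (hpos'.and (hconc.and (hlog.and (hpos.and (eventually_gt_atTop (0 : ℝ))))))))
  refine ⟨u', c, (hc c le_rfl).2.2.2.2.2.2, antitoneOn_Ici_of_hasDerivAt
    (fun t ht => (hc t ht).2.1) (fun t ht => (hc t ht).2.2.2.1), fun t ht => ?_⟩
  obtain ⟨h1, -, h3, -, h5, h6, -⟩ := hc t ht
  exact ⟨h6, h1, h3, h5⟩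

theorem IsHardyField.isSublinearConcave {H : Subring (ℝ → ℝ)} (hH : IsHardyField H)
    (hid : (fun t => t) ∈ H) {u : ℝ → ℝ} (hu : u ∈ H) {ε : ℝ} (hε : 0 < ε)
    (hpos : ∀ᶠ t in atTop, 0 < u t) (hlow : (fun t => t ^ ε) =o[atTop] u)
    (hup : u =o[atTop] fun t => t) : IsSublinearConcave fun n => u n := by
  obtain ⟨htop, u', c, hc0, hanti, hc⟩ := hH.exists_regular hid hu hε hpos hlow hup
  refine ⟨htop.comp tendsto_natCast_atTop_atTop,
    hup.tendsto_div_nhds_zero.comp tendsto_natCast_atTop_atTop, ⌈c⌉₊, ε, hε, fun n hn => ?_⟩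
  have hn : c ≤ n := Nat.ceil_le.1 hn
  have mvt : ∀ x ≥ c, u' (x + 1) ≤ u (x + 1) - u x ∧ u (x + 1) - u x ≤ u' x := by
    intro x hx
    obtain ⟨ξ, hξ, h⟩ := exists_hasDerivAt_eq_slope u u' (lt_add_one x)
      (fun t ht => (hc t (hx.trans ht.1)).2.1.continuousAt.continuousWithinAt)
      (fun t ht => (hc t (hx.trans ht.1.le)).2.1)
    have h : u (x + 1) - u x = u' ξ := by rw [h]; simp
    have hξ' : c ≤ ξ := hx.trans hξ.1.le
    exact ⟨h ▸ hanti hξ' (hξ'.trans hξ.2.le) hξ.2.le, h ▸ hanti hx hξ' hξ.1.le⟩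
  have hn1 : c ≤ n + 1 := hn.trans (by linarith)
  obtain ⟨h1, h2⟩ := mvt n hn
  obtain ⟨h3, h4⟩ := mvt (n + 1) hn1
  obtain ⟨-, -, h5, h6⟩ := hc (n + 1) hn1
  have hlt : u n < u (n + 1) := by linarith
  push_cast
  rw [show (n : ℝ) + 2 = n + 1 + 1 by ring]
  refine ⟨(hc n hn).1, hlt, h4.trans h1, ?_⟩
  have hn2 : (0 : ℝ) < n + 1 := by linarith
  calc ε * u n ≤ ε * u (n + 1) := by gcongr
    _ ≤ (n + 1) * u' (n + 1) := h6
    _ ≤ _ := by gcongr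

theorem IsLogExp.isSublinearConcave {a : ℝ → ℝ} (ha : IsLogExp a) (hG : IsFractionalGrowth a)
    (hsub : GrowsSlower a fun t => t) :
    IsSublinearConcave (fun n => a n) ∨ IsSublinearConcave (fun n => -a n) := by
  obtain ⟨H, hH, hid, haH⟩ := ha.exists_isHardyField
  obtain ⟨-, k, ε, hε, hlow, -⟩ := hG
  have hε' : 0 < (k : ℝ) + ε := by positivity
  rcases hH.sign haH with h | h | h
  · exact .inl (hH.isSublinearConcave hid haH hε' h hlow hsub)
  · exfalso
    obtain ⟨t, h1, h2, h3⟩ := ((hlow.bound one_pos).and (h.and (eventually_gt_atTop 0))).exists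
    rw [h2, norm_zero, mul_zero, Real.norm_of_nonneg (Real.rpow_nonneg h3.le _)] at h1
    exact absurd (Real.rpow_pos_of_pos h3 _) (not_lt.2 h1)
  · exact .inr (hH.isSublinearConcave hid (neg_mem haH) hε' (h.mono fun t h => by simpa using h)
      hlow.neg_right hsub.neg_left)

theorem norm_sum_le_card_mul {ι E : Type*} [NormedAddCommGroup E] {S : Finset ι} {F : ι → E}
    {M : ℝ} (h : ∀ n ∈ S, ‖F n‖ ≤ M) : ‖∑ n ∈ S, F n‖ ≤ S.card * M := by
  simpa using (norm_sum_le S F).trans (Finset.sum_le_card_nsmul S _ M h)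

/-- Two sums are close to each other if an injection that rarely leaves the index set matches most
of their terms. -/
theorem norm_sum_sub_sum_le_of_injOn {E : Type*} [NormedAddCommGroup E] {S : Finset ℕ}
    {F F' : ℕ → E} {σ : ℕ → ℕ} {M : ℝ} (hF : ∀ n, ‖F n‖ ≤ M) (hF' : ∀ n, ‖F' n‖ ≤ M)
    (hσ : Set.InjOn σ S) (P : ℕ → Prop) [DecidablePred P]
    (hP : ∀ n ∈ S, σ n ∈ S → ¬ P n → F (σ n) = F' n) :
    ‖∑ n ∈ S, F n - ∑ n ∈ S, F' n‖ ≤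
      2 * M * ((S.filter fun n => σ n ∉ S).card + (S.filter fun n => σ n ∈ S ∧ P n).card) := by
  set S' := S.filter fun n => σ n ∈ S with hS'
  have hsub : S' ⊆ S := Finset.filter_subset _ _
  have hinj : Set.InjOn σ S' := hσ.mono (by exact_mod_cast hsub)
  have himg : S'.image σ ⊆ S := by
    intro m hm
    obtain ⟨n, hn, rfl⟩ := Finset.mem_image.1 hm
    exact (Finset.mem_filter.1 hn).2
  have hcard : (S \ S').card = (S.filter fun n => σ n ∉ S).card := by
    rw [hS', ← Finset.filter_not]
  have hcard' : (S \ S'.image σ).card = (S.filter fun n => σ n ∉ S).card := by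
    rw [← hcard, Finset.card_sdiff_of_subset himg, Finset.card_sdiff_of_subset hsub,
      Finset.card_image_of_injOn hinj]
  have hM : 0 ≤ M := (norm_nonneg _).trans (hF 0)
  have hmid : ‖∑ n ∈ S', (F (σ n) - F' n)‖ ≤
      (S.filter fun n => σ n ∈ S ∧ P n).card * (2 * M) := by
    have : ∑ n ∈ S', (F (σ n) - F' n) =
        ∑ n ∈ S.filter fun n => σ n ∈ S ∧ P n, (F (σ n) - F' n) := by
      rw [← Finset.filter_filter, ← hS']
      refine (Finset.sum_subset (Finset.filter_subset _ _) fun n hn hn' => ?_).symm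
      obtain ⟨h1, h2⟩ := Finset.mem_filter.1 hn
      rw [hP n h1 h2 (fun h => hn' (Finset.mem_filter.2 ⟨hn, h⟩)), sub_self]
    rw [this]
    refine norm_sum_le_card_mul fun n _ => (norm_sub_le _ _).trans ?_
    linarith [hF (σ n), hF' n]
  have hsplit : ∑ n ∈ S, F n - ∑ n ∈ S, F' n =
      ∑ n ∈ S \ S'.image σ, F n + ∑ n ∈ S', (F (σ n) - F' n) - ∑ n ∈ S \ S', F' n := by
    rw [← Finset.sum_sdiff himg, ← Finset.sum_sdiff hsub (f := F'), Finset.sum_image hinj,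
      Finset.sum_sub_distrib]
    abel
  rw [hsplit]
  have h1 := norm_sum_le_card_mul (S := S \ S'.image σ) fun n _ => hF n
  have h2 := norm_sum_le_card_mul (S := S \ S') fun n _ => hF' n
  rw [hcard'] at h1
  rw [hcard] at h2
  calc _ ≤ _ := norm_sub_le _ _
    _ ≤ _ := add_le_add_left (norm_add_le _ _) _
    _ ≤ _ := add_le_add (add_le_add h1 hmid) h2
    _ = _ := by ring

open Classical in
/-- The number of `j < N` satisfying `D`. -/
noncomputable def countBelow (D : ℕ → Prop) (N : ℕ) : ℕ := ((Finset.range N).filter D).card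

theorem countBelow_succ_le (D : ℕ → Prop) (N : ℕ) :
    countBelow D (N + 1) ≤ countBelow D N + 1 := by
  classical
  rw [countBelow, Finset.range_add_one, Finset.filter_insert]
  split_ifs
  · exact Finset.card_insert_le _ _
  · exact Nat.le_succ _

theorem countBelow_le (D : ℕ → Prop) (N : ℕ) : countBelow D N ≤ N := by
  classical
  exact (Finset.card_filter_le _ _).trans (by simp)

theorem countBelow_succ_of_not {D : ℕ → Prop} {N : ℕ} (h : ¬ D N) :
    countBelow D (N + 1) = countBelow D N := by
  classical
  rw [countBelow, Finset.range_add_one, Finset.filter_insert, if_neg h, countBelow]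

namespace IsSublinearConcave

variable {u : ℕ → ℝ}

/-- An integer-valued sequence read off from `u` by rounding changes at most about `u N` times. -/
theorem exists_countBelow_le (hu : IsSublinearConcave u) {κ : ℝ → ℤ} (hκ : Monotone κ)
    (hκ' : ∀ x, |(κ x : ℝ) - x| ≤ 1) :
    ∃ C : ℝ, ∀ N, (countBelow (fun j => κ (u (j + 1)) ≠ κ (u j)) N : ℝ) ≤ C + |u N| := by
  obtain ⟨n₀, ε, hε, h⟩ := hu.exists_bounds
  have key : ∀ d : ℕ, (countBelow (fun j => κ (u (j + 1)) ≠ κ (u j)) (n₀ + d) : ℤ) ≤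
      n₀ + (κ (u (n₀ + d)) - κ (u n₀)) := by
    intro d
    induction d with
    | zero => simpa using countBelow_le _ _
    | succ d ih =>
      have hle : κ (u (n₀ + d)) ≤ κ (u (n₀ + d + 1)) := hκ (h (n₀ + d) (by omega)).2.1.le
      by_cases hd : κ (u (n₀ + d + 1)) = κ (u (n₀ + d))
      · rw [← add_assoc, countBelow_succ_of_not (by simpa using hd), hd]
        exact ih
      · have := countBelow_succ_le (fun j => κ (u (j + 1)) ≠ κ (u j)) (n₀ + d)
        rw [← add_assoc]
        zify at this
        omega
  refine ⟨n₀ + 1 + |(κ (u n₀) : ℝ)|, fun N => ?_⟩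
  rcases le_total n₀ N with hN | hN
  · obtain ⟨d, rfl⟩ := Nat.exists_eq_add_of_le hN
    have h1 : (countBelow (fun j => κ (u (j + 1)) ≠ κ (u j)) (n₀ + d) : ℝ) ≤
      n₀ + (κ (u (n₀ + d)) - κ (u n₀)) := by exact_mod_cast key d
    have h2 := (abs_le.1 (hκ' (u (n₀ + d)))).2
    have h3 := le_abs_self (u (n₀ + d))
    have h4 := neg_abs_le (κ (u n₀) : ℝ)
    linarith
  · have h1 : (countBelow (fun j => κ (u (j + 1)) ≠ κ (u j)) N : ℝ) ≤ n₀ := by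
      exact_mod_cast (countBelow_le _ N).trans hN
    have h2 := abs_nonneg (u N)
    have h3 := abs_nonneg (κ (u n₀) : ℝ)
    linarith

/-- The first index from which on `u` exceeds `u n` by at least `1`. -/
noncomputable def jump (u : ℕ → ℝ) (n : ℕ) : ℕ := sInf {j | n ≤ j ∧ u n + 1 ≤ u j}

theorem jump_mem (hu : IsSublinearConcave u) (n : ℕ) : n ≤ jump u n ∧ u n + 1 ≤ u (jump u n) :=
  Nat.sInf_mem (s := {j | n ≤ j ∧ u n + 1 ≤ u j})
    ((eventually_ge_atTop n).and (hu.tendsto_atTop.eventually_ge_atTop (u n + 1))).exists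

theorem lt_jump (hu : IsSublinearConcave u) (n : ℕ) : n < jump u n := by
  obtain ⟨h1, h2⟩ := hu.jump_mem n
  refine lt_of_le_of_ne h1 fun h => ?_
  rw [← h] at h2
  linarith

theorem lt_of_lt_jump {n j : ℕ} (h1 : n ≤ j) (h2 : j < jump u n) : u j < u n + 1 := by
  by_contra hcon
  exact Nat.notMem_of_lt_sInf h2 ⟨h1, not_lt.1 hcon⟩

/-- The essential estimate: weighted sums of a bounded coboundary along `κ (u n)` are controlled by
the number of changes of the weights. -/
theorem exists_norm_sum_le (hu : IsSublinearConcave u) {κ : ℝ → ℤ} (hκ : Monotone κ)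
    (hκ1 : ∀ x, κ (x + 1) = κ x + 1) {𝕜 : Type*} [RCLike 𝕜] :
    ∃ n₀ : ℕ, ∃ ε > 0, ∀ (D : ℕ → Prop) (g : ℕ → 𝕜) (H : ℤ → 𝕜) (G B : ℝ),
      (∀ n, ‖g n‖ ≤ G) → (∀ m, ‖H m‖ ≤ B) → (∀ j, ¬ D j → g (j + 1) = g j) → ∀ N ≥ n₀,
        ‖∑ n ∈ Finset.Icc 1 N, g n * (H (κ (u n)) - H (κ (u n) + 1))‖ ≤
          2 * (G * B) * (n₀ + ((N + 1) / (ε * u N) + 1) * (1 + countBelow D N) +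
            (countBelow (fun j => κ (u (j + 1)) ≠ κ (u j)) N + 1)) := by
  classical
  obtain ⟨n₁, ε, hε, hb⟩ := hu.exists_bounds
  set n₀ := n₁ + 1
  replace hb : ∀ n ≥ n₀, 0 < u n ∧ u n < u (n + 1) ∧
    u (n + 2) - u (n + 1) ≤ u (n + 1) - u n ∧ ε * u n ≤ (n + 1) * (u (n + 1) - u n) :=
    fun n hn => hb n (by omega)
  refine ⟨n₀, ε, hε, fun D g H G B hg hH hD N hN => ?_⟩
  have hG : 0 ≤ G := (norm_nonneg _).trans (hg 0)
  have hB : 0 ≤ B := (norm_nonneg _).trans (hH 0)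
  have hmono : ∀ n ≥ n₀, ∀ m ≥ n, u n ≤ u m := by
    intro n hn m hm
    induction m, hm using Nat.le_induction with
    | base => exact le_rfl
    | succ m hm ih => exact ih.trans (hb m (hn.trans hm)).2.1.le
  have hincr : ∀ n ≥ n₀, ∀ m ≥ n, u (m + 1) - u m ≤ u (n + 1) - u n := by
    intro n hn m hm
    induction m, hm using Nat.le_induction with
    | base => exact le_rfl
    | succ m hm ih => exact (hb m (hn.trans hm)).2.2.1.trans ih
  set δ := u (N + 1) - u N with hδ
  have hδ0 : 0 < δ := sub_pos.2 (hb N hN).2.1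
  have hslope : ∀ n ≥ n₀, ∀ d : ℕ, n + d ≤ N → d * δ ≤ u (n + d) - u n := by
    intro n hn d
    induction d with
    | zero => simp
    | succ d ih =>
      intro hd
      have h1 := ih (by omega)
      have h2 := hincr (n + d) (by omega) N (by omega)
      rw [← add_assoc]
      push_cast
      linarith
  set w := ⌊1 / δ⌋₊ + 1 with hw
  have hshort : ∀ n ≥ n₀, ∀ m ≥ n, m ≤ N → u m < u n + 1 → m < n + w := by
    intro n hn m hm hmN h
    obtain ⟨d, rfl⟩ := Nat.exists_eq_add_of_le hm
    have h1 := hslope n hn d hmN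
    have h2 : (d : ℝ) ≤ 1 / δ := by
      rw [le_div_iff₀ hδ0]
      linarith
    have := Nat.le_floor h2
    omega
  have hwle : (w : ℝ) ≤ (N + 1) / (ε * u N) + 1 := by
    have h1 : 1 / δ ≤ (N + 1) / (ε * u N) := by
      rw [div_le_div_iff₀ hδ0 (mul_pos hε (hb N hN).1), one_mul]
      exact (hb N hN).2.2.2
    have h2 := Nat.floor_le (a := 1 / δ) (by positivity)
    rw [hw]
    push_cast
    linarith
  have hjump_lt : ∀ n ≥ n₀, u (jump u n) < u (n + 1) + 1 := by
    intro n hn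
    have h1 := hu.lt_jump n
    obtain ⟨m, hm⟩ : ∃ m, jump u n = m + 1 := ⟨jump u n - 1, by omega⟩
    have h2 : u m < u n + 1 := lt_of_lt_jump (by omega) (by omega)
    have h3 := hincr n hn m (by omega)
    rw [hm]
    linarith
  have hjump_ne : ∀ n ≥ n₀, ∀ m > n, jump u n ≠ jump u m := by
    intro n hn m hm h
    have h1 := hjump_lt n hn
    have h2 := (hu.jump_mem m).2
    have h3 := hmono (n + 1) (by omega) m hm
    rw [h] at h1
    linarith
  set S := Finset.Icc n₀ N with hS
  have hmemS : ∀ n ∈ S, n₀ ≤ n ∧ n ≤ N := fun n hn => Finset.mem_Icc.1 hn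
  have hinj : Set.InjOn (jump u) S := by
    intro n hn m hm h
    rcases lt_trichotomy n m with hlt | heq | hlt
    · exact absurd h (hjump_ne n (hmemS n hn).1 m hlt)
    · exact heq
    · exact absurd h.symm (hjump_ne m (hmemS m hm).1 n hlt)
  have hgconst : ∀ n m, n ≤ m → (∀ j, n ≤ j → j < m → ¬ D j) → g m = g n := by
    intro n m hnm
    induction m, hnm using Nat.le_induction with
    | base => exact fun _ => rfl
    | succ m hm ih =>
      intro h
      rw [hD m (h m hm (Nat.lt_succ_self m)), ih fun j h1 h2 => h j h1 (by omega)]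
  have hmatch := norm_sum_sub_sum_le_of_injOn (S := S) (F := fun n => g n * H (κ (u n)))
    (F' := fun n => g n * H (κ (u n) + 1)) (M := G * B)
    (fun n => (norm_mul _ _).trans_le (mul_le_mul (hg _) (hH _) (norm_nonneg _) hG))
    (fun n => (norm_mul _ _).trans_le (mul_le_mul (hg _) (hH _) (norm_nonneg _) hG)) hinj
    (fun n => κ (u (n + 1)) ≠ κ (u n) ∨ ∃ j, n ≤ j ∧ j < jump u n ∧ D j) (by
      intro n hn _ hP
      push Not at hP
      have h1 : κ (u (jump u n)) = κ (u n) + 1 := by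
        apply le_antisymm
        · rw [← hP.1, ← hκ1]
          exact hκ (hjump_lt n (hmemS n hn).1).le
        · rw [← hκ1]
          exact hκ (hu.jump_mem n).2
      simp only [h1, hgconst n (jump u n) (hu.lt_jump n).le hP.2])
  have hcard1 : (S.filter fun n => jump u n ∉ S).card ≤ w := by
    have : (S.filter fun n => jump u n ∉ S) ⊆ Finset.Ico (N + 1 - w) (N + 1) := by
      intro n hn
      obtain ⟨h1, h2⟩ := Finset.mem_filter.1 hn
      obtain ⟨h3, h4⟩ := hmemS n h1
      have h5 := hu.lt_jump n
      have h6 : N < jump u n := by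
        by_contra h
        exact h2 (Finset.mem_Icc.2 ⟨by omega, by omega⟩)
      have := hshort n h3 N h4 le_rfl (lt_of_lt_jump h4 h6)
      exact Finset.mem_Ico.2 ⟨by omega, by omega⟩
    refine (Finset.card_le_card this).trans ?_
    rw [Nat.card_Ico]
    omega
  have hcard2 : (S.filter fun n => jump u n ∈ S ∧
      (κ (u (n + 1)) ≠ κ (u n) ∨ ∃ j, n ≤ j ∧ j < jump u n ∧ D j)).card ≤
      (countBelow (fun j => κ (u (j + 1)) ≠ κ (u j)) N + 1) + countBelow D N * w := by
    have hsub : (S.filter fun n => jump u n ∈ S ∧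
        (κ (u (n + 1)) ≠ κ (u n) ∨ ∃ j, n ≤ j ∧ j < jump u n ∧ D j)) ⊆
        ((Finset.range (N + 1)).filter fun j => κ (u (j + 1)) ≠ κ (u j)) ∪
          ((Finset.range N).filter D).biUnion fun j => Finset.Ico (j + 1 - w) (j + 1) := by
      intro n hn
      obtain ⟨h1, h2, h3⟩ := Finset.mem_filter.1 hn
      obtain ⟨h4, h5⟩ := hmemS n h1
      have h6 := (hmemS _ h2).2
      rcases h3 with h3 | ⟨j, h7, h8, h9⟩
      · exact Finset.mem_union_left _ (Finset.mem_filter.2 ⟨Finset.mem_range.2 (by omega), h3⟩)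
      · refine Finset.mem_union_right _ (Finset.mem_biUnion.2 ⟨j, Finset.mem_filter.2
          ⟨Finset.mem_range.2 (by omega), h9⟩, Finset.mem_Ico.2 ⟨?_, by omega⟩⟩)
        have := hshort n h4 j h7 (by omega) (lt_of_lt_jump h7 h8)
        omega
    refine (Finset.card_le_card hsub).trans ((Finset.card_union_le _ _).trans
      (add_le_add ?_ ?_))
    · refine le_trans (le_of_eq ?_) (countBelow_succ_le _ N)
      simp only [countBelow]
      congr
    · refine (Finset.card_biUnion_le_card_mul _ _ w fun j _ => ?_).trans (le_of_eq ?_)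
      · rw [Nat.card_Ico]
        omega
      · simp only [countBelow]
  have hfirst : ‖∑ n ∈ Finset.Ico 1 n₀, g n * (H (κ (u n)) - H (κ (u n) + 1))‖ ≤
      n₀ * (2 * (G * B)) := by
    refine (norm_sum_le_card_mul (M := 2 * (G * B)) fun n _ => ?_).trans ?_
    · rw [norm_mul]
      have h1 := (norm_sub_le (H (κ (u n))) (H (κ (u n) + 1))).trans (add_le_add (hH _) (hH _))
      calc _ ≤ G * (B + B) := mul_le_mul (hg n) h1 (norm_nonneg _) hG
        _ = _ := by ring
    · rw [Nat.card_Ico]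
      gcongr
      omega
  have hsplit : ∑ n ∈ Finset.Icc 1 N, g n * (H (κ (u n)) - H (κ (u n) + 1)) =
      ∑ n ∈ Finset.Ico 1 n₀, g n * (H (κ (u n)) - H (κ (u n) + 1)) +
        (∑ n ∈ S, g n * H (κ (u n)) - ∑ n ∈ S, g n * H (κ (u n) + 1)) := by
    rw [← Finset.sum_sub_distrib, ← Finset.Ico_add_one_right_eq_Icc, hS,
      ← Finset.Ico_add_one_right_eq_Icc,
      ← Finset.sum_Ico_consecutive _ (show 1 ≤ n₀ by omega) (show n₀ ≤ N + 1 by omega)]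
    simp only [mul_sub]
  rw [hsplit]
  refine (norm_add_le _ _).trans ((add_le_add hfirst hmatch).trans ?_)
  have h1 : ((S.filter fun n => jump u n ∉ S).card : ℝ) ≤ w := by exact_mod_cast hcard1
  have h2 : ((S.filter fun n => jump u n ∈ S ∧
      (κ (u (n + 1)) ≠ κ (u n) ∨ ∃ j, n ≤ j ∧ j < jump u n ∧ D j)).card : ℝ) ≤
      (countBelow (fun j => κ (u (j + 1)) ≠ κ (u j)) N + 1) + countBelow D N * w := by
    exact_mod_cast hcard2
  calc _ ≤ n₀ * (2 * (G * B)) + 2 * (G * B) *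
        (w + ((countBelow (fun j => κ (u (j + 1)) ≠ κ (u j)) N + 1) + countBelow D N * w)) := by
        gcongr
    _ = 2 * (G * B) * (n₀ + w * (1 + countBelow D N) +
          (countBelow (fun j => κ (u (j + 1)) ≠ κ (u j)) N + 1)) := by ring
    _ ≤ _ := by gcongr

theorem exists_tendsto_zero_norm_average_le (hu : IsSublinearConcave u) {κ : ℝ → ℤ}
    (hκ : Monotone κ) (hκ1 : ∀ x, κ (x + 1) = κ x + 1) (hκ' : ∀ x, |(κ x : ℝ) - x| ≤ 1)
    {D : ℕ → Prop} (hD : Tendsto (fun N => countBelow D N / u N) atTop (𝓝 0))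
    (𝕜 : Type*) [RCLike 𝕜] :
    ∃ E : ℕ → ℝ, Tendsto E atTop (𝓝 0) ∧ ∀ᶠ N : ℕ in atTop,
      ∀ (g : ℕ → 𝕜) (H : ℤ → 𝕜) (G B : ℝ), (∀ n, ‖g n‖ ≤ G) → (∀ m, ‖H m‖ ≤ B) →
        (∀ j, ¬ D j → g (j + 1) = g j) →
        ‖(N : 𝕜)⁻¹ * ∑ n ∈ Finset.Icc 1 N, g n * (H (κ (u n)) - H (κ (u n) + 1))‖ ≤
          G * B * E N := by
  obtain ⟨n₀, ε, hε, h⟩ := hu.exists_norm_sum_le hκ hκ1 (𝕜 := 𝕜)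
  obtain ⟨C, hC⟩ := hu.exists_countBelow_le hκ hκ'
  have hinv : Tendsto (fun N : ℕ => (N : ℝ)⁻¹) atTop (𝓝 0) := tendsto_inv_atTop_nhds_zero_nat
  have huinv : Tendsto (fun N : ℕ => (u N)⁻¹) atTop (𝓝 0) := hu.tendsto_atTop.inv_tendsto_atTop
  have hu_div := hu.tendsto_div
  refine ⟨fun N => 2 * (n₀ * (N : ℝ)⁻¹ + ((1 + (N : ℝ)⁻¹) / ε) * ((u N)⁻¹ + countBelow D N / u N) +
    ((N : ℝ)⁻¹ + countBelow D N / u N * (u N / N)) + ((C + 1) * (N : ℝ)⁻¹ + u N / N)), ?_, ?_⟩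
  · have h1 : Tendsto (fun N : ℕ => (1 + (N : ℝ)⁻¹) / ε) atTop (𝓝 ((1 + 0) / ε)) :=
      (hinv.const_add 1).div_const ε
    have := ((((hinv.const_mul (n₀ : ℝ)).add (h1.mul (huinv.add hD))).add
      (hinv.add (hD.mul hu_div))).add ((hinv.const_mul (C + 1)).add hu_div)).const_mul 2
    simpa using this
  · filter_upwards [eventually_ge_atTop n₀, eventually_gt_atTop 0,
      hu.tendsto_atTop.eventually_gt_atTop 0] with N hN hN0 huN g H G B hg hH hgD
    have hG : 0 ≤ G := (norm_nonneg _).trans (hg 0)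
    have hB : 0 ≤ B := (norm_nonneg _).trans (hH 0)
    have hNpos : (0 : ℝ) < N := by exact_mod_cast hN0
    have hCN := hC N
    rw [abs_of_pos huN] at hCN
    rw [norm_mul, norm_inv, RCLike.norm_natCast]
    calc (N : ℝ)⁻¹ * _ ≤ (N : ℝ)⁻¹ * (2 * (G * B) * (n₀ + ((N + 1) / (ε * u N) + 1) *
            (1 + countBelow D N) + (C + u N + 1))) := by
          gcongr
          refine (h D g H G B hg hH hgD N hN).trans ?_
          gcongr
      _ = _ := by
          field_simp
          ring

end IsSublinearConcave

theorem sub_average_eq_coboundary {X 𝕜 : Type*} [RCLike 𝕜] (T : X → X) (φ : X → 𝕜) {N : ℕ} (hN : N ≠ 0) (x : X) :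
    φ x - ((N : 𝕜)⁻¹ * ∑ j ∈ Finset.range N, birkhoffSum T φ j x -
      (N : 𝕜)⁻¹ * ∑ j ∈ Finset.range N, birkhoffSum T φ j (T x)) = birkhoffAverage 𝕜 T φ N x := by
  have hN' : (N : 𝕜) ≠ 0 := Nat.cast_ne_zero.2 hN
  have h : ∀ j, birkhoffSum T φ j x - birkhoffSum T φ j (T x) = φ x - φ (T^[j] x) := fun j => by
    rw [← neg_sub, birkhoffSum_apply_sub_birkhoffSum, neg_sub]
  rw [← mul_sub, ← Finset.sum_sub_distrib, Finset.sum_congr rfl fun j _ => h j,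
    Finset.sum_sub_distrib, birkhoffAverage, birkhoffSum]
  simp only [Finset.sum_const, Finset.card_range, nsmul_eq_mul, smul_eq_mul]
  field_simp
  ring

section MeanErgodic

variable {X : Type*} [MeasurableSpace X] {μ : Measure X} {𝕜 : Type*} [RCLike 𝕜]

theorem aestronglyMeasurable_invariants_of_ae_comp_eq {T : X → X} (hT : MeasurePreserving T μ μ)
    {v : X → 𝕜} (hv : AEStronglyMeasurable v μ) (h : v ∘ T =ᵐ[μ] v) :
    AEStronglyMeasurable[MeasurableSpace.invariants T] v μ := by
  set w := hv.mk v with hw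
  have hwm : StronglyMeasurable w := hv.stronglyMeasurable_mk
  have hvw : v =ᵐ[μ] w := hv.ae_eq_mk
  have hwT : w ∘ T =ᵐ[μ] w :=
    ((hT.quasiMeasurePreserving.ae_eq_comp hvw).symm.trans h).trans hvw
  have hlim : StronglyMeasurable fun x => limUnder atTop fun n : ℕ => w (T^[n] x) :=
    StronglyMeasurable.limUnder fun n =>
      hwm.comp_measurable (hT.measurable.iterate n)
  refine ⟨fun x => limUnder atTop fun n : ℕ => w (T^[n] x), ?_, ?_⟩
  · refine Measurable.stronglyMeasurable (MeasurableSpace.measurable_invariants_dom.2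
      ⟨hlim.measurable, fun s _ => ?_⟩)
    congr 1
    ext x
    have : (fun n : ℕ => w (T^[n] (T x))) = (fun n : ℕ => w (T^[n] x)) ∘ fun n => n + 1 := by
      ext n
      simp [Function.iterate_succ_apply]
    simp only [Function.comp_apply, limUnder, this]
    rw [← Filter.map_map, map_add_atTop_eq_nat]
  · have hall : ∀ᵐ x ∂μ, ∀ n : ℕ, w (T^[n] x) = w x := by
      rw [ae_all_iff]
      intro n
      induction n with
      | zero => simp
      | succ n ih =>
        filter_upwards [(hT.iterate n).quasiMeasurePreserving.ae hwT, ih] with x h1 h2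
        rw [Function.iterate_succ_apply']
        exact h1.trans h2
    filter_upwards [hvw, hall] with x h1 h2
    rw [h1]
    simp only [h2]
    exact tendsto_const_nhds.limUnder_eq.symm

theorem stronglyMeasurable_birkhoffSum {T : X → X} (hT : Measurable T) {φ : X → 𝕜}
    (hφ : StronglyMeasurable φ) (n : ℕ) : StronglyMeasurable (birkhoffSum T φ n) :=
  Finset.stronglyMeasurable_fun_sum _ fun j _ => hφ.comp_measurable (hT.iterate j)

theorem tendsto_eLpNorm_birkhoffAverage_zero [IsProbabilityMeasure μ] {T : X → X}
    (hT : MeasurePreserving T μ μ) {φ : X → 𝕜} (hφ : MemLp φ 2 μ)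
    (h0 : μ[φ | MeasurableSpace.invariants T] =ᵐ[μ] 0) :
    Tendsto (fun N => eLpNorm (birkhoffAverage 𝕜 T φ N) 2 μ) atTop (𝓝 0) := by
  have hm := MeasurableSpace.invariants_le T
  set U : Lp 𝕜 2 μ →L[𝕜] Lp 𝕜 2 μ :=
    (Lp.compMeasurePreservingₗᵢ 𝕜 T hT).toContinuousLinearMap with hU
  have hU1 : ‖U‖ ≤ 1 := LinearIsometry.norm_toContinuousLinearMap_le _
  set v : Lp 𝕜 2 μ := hφ.toLp φ with hv
  have hzero : (U.eqLocus (1 : Lp 𝕜 2 μ →L[𝕜] Lp 𝕜 2 μ)).orthogonalProjectionOnto v = 0 := by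
    rw [Submodule.orthogonalProjectionOnto_eq_zero_iff, Submodule.mem_orthogonal]
    intro w hw
    have hw' : U w = w := hw
    have hwT : w ∘ T =ᵐ[μ] w := by
      have := Lp.coeFn_compMeasurePreserving w hT
      have h2 : Lp.compMeasurePreserving T hT w = w := hw'
      rw [h2] at this
      exact this.symm
    have hwm : w ∈ lpMeas 𝕜 𝕜 (MeasurableSpace.invariants T) 2 μ :=
      mem_lpMeas_iff_aestronglyMeasurable.2
        (aestronglyMeasurable_invariants_of_ae_comp_eq hT (Lp.aestronglyMeasurable w) hwT)
    have hw2 : (condExpL2 𝕜 𝕜 hm w : Lp 𝕜 2 μ) = w := by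
      have : Fact (MeasurableSpace.invariants T ≤ ‹MeasurableSpace X›) := ⟨hm⟩
      exact congrArg Subtype.val (Submodule.orthogonalProjectionOnto_mem_subspace_eq_self
        (K := lpMeas 𝕜 𝕜 (MeasurableSpace.invariants T) 2 μ) ⟨w, hwm⟩)
    have hv0 : (condExpL2 𝕜 𝕜 hm v : Lp 𝕜 2 μ) = 0 := by
      rw [Lp.eq_zero_iff_ae_eq_zero]
      exact (hφ.condExpL2_ae_eq_condExp hm).trans h0
    rw [← hw2, inner_condExpL2_left_eq_right, hv0, inner_zero_right]
  have hconv := U.tendsto_birkhoffAverage_orthogonalProjection hU1 v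
  rw [hzero] at hconv
  have hiter : ∀ n, U^[n] v = (hφ.comp_measurePreserving (hT.iterate n)).toLp := by
    intro n
    have h1 : U^[n] v = Lp.compMeasurePreserving T^[n] (hT.iterate n) v := by
      rw [← Lp.compMeasurePreserving_iterate hT n]
      rfl
    rw [h1, hv, Lp.toLp_compMeasurePreserving]
  have hsum : ∀ N, (birkhoffSum U _root_.id N v : Lp 𝕜 2 μ) =ᵐ[μ] birkhoffSum T φ N := by
    intro N
    induction N with
    | zero => exact Lp.coeFn_zero 𝕜 2 μ
    | succ N ih =>
      rw [birkhoffSum_succ, id, hiter]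
      filter_upwards [Lp.coeFn_add (birkhoffSum U _root_.id N v)
        (hφ.comp_measurePreserving (hT.iterate N)).toLp, ih,
        (hφ.comp_measurePreserving (hT.iterate N)).coeFn_toLp] with x h1 h2 h3
      rw [h1, birkhoffSum_succ, Pi.add_apply, h2, h3, Function.comp_apply]
  have havg : ∀ N, ‖birkhoffAverage 𝕜 U _root_.id N v‖ₑ =
      eLpNorm (birkhoffAverage 𝕜 T φ N) 2 μ := by
    intro N
    rw [Lp.enorm_def]
    refine eLpNorm_congr_ae ?_
    filter_upwards [Lp.coeFn_smul ((N : 𝕜)⁻¹) (birkhoffSum U _root_.id N v), hsum N] with x h1 h2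
    rw [birkhoffAverage, h1, Pi.smul_apply, h2, birkhoffAverage]
  have hnorm := hconv.enorm
  simpa only [havg, ZeroMemClass.coe_zero, enorm_zero] using hnorm

/-- A bounded function with vanishing conditional expectation with respect to the invariant
`σ`-algebra is close in `L²` to the coboundary of a bounded function. -/
theorem exists_coboundary_approx [IsProbabilityMeasure μ] {T : X → X}
    (hT : MeasurePreserving T μ μ) {φ : X → 𝕜} (hφ : StronglyMeasurable φ) {C : ℝ}
    (hC : ∀ x, ‖φ x‖ ≤ C) (h0 : μ[φ | MeasurableSpace.invariants T] =ᵐ[μ] 0)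
    {δ : ℝ≥0∞} (hδ : 0 < δ) :
    ∃ h : X → 𝕜, StronglyMeasurable h ∧ (∃ B, ∀ x, ‖h x‖ ≤ B) ∧
      eLpNorm (fun x => φ x - (h x - h (T x))) 2 μ ≤ δ := by
  have hφ2 : MemLp φ 2 μ := .of_bound hφ.aestronglyMeasurable C (.of_forall hC)
  obtain ⟨N, hN, hN0⟩ := (((tendsto_eLpNorm_birkhoffAverage_zero hT hφ2 h0).eventually_le_const
    hδ).and (eventually_ne_atTop 0)).exists
  refine ⟨fun x => (N : 𝕜)⁻¹ * ∑ j ∈ Finset.range N, birkhoffSum T φ j x, ?_,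
    ⟨‖(N : 𝕜)⁻¹‖ * ∑ j ∈ Finset.range N, j * C, fun x => ?_⟩, ?_⟩
  · exact (Finset.stronglyMeasurable_fun_sum _ fun j _ =>
      stronglyMeasurable_birkhoffSum hT.measurable hφ j).const_mul _
  · rw [norm_mul]
    gcongr
    refine norm_sum_le_of_le _ fun j _ => ?_
    exact (norm_sum_le_card_mul (S := Finset.range j) fun i _ => hC (T^[i] x)).trans_eq
      (by rw [Finset.card_range])
  · simpa only [sub_average_eq_coboundary T φ hN0] using hN

/-- A strictly invariant bounded version of the conditional expectation. -/
theorem exists_invariant_version_condExp [IsProbabilityMeasure μ] (T : X → X) {f : X → 𝕜} {C : ℝ}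
    (hC0 : 0 ≤ C) (hC : ∀ᵐ x ∂μ, ‖f x‖ ≤ C) :
    ∃ F : X → 𝕜, StronglyMeasurable[MeasurableSpace.invariants T] F ∧ (∀ x, F (T x) = F x) ∧
      (∀ x, ‖F x‖ ≤ C) ∧ F =ᵐ[μ] μ[f | MeasurableSpace.invariants T] := by
  set G := μ[f | MeasurableSpace.invariants T] with hG
  have hGm : StronglyMeasurable[MeasurableSpace.invariants T] G := stronglyMeasurable_condExp
  have hs : MeasurableSet[MeasurableSpace.invariants T] {x | ‖G x‖ ≤ C} :=
    hGm.norm.measurableSet_le stronglyMeasurable_const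
  have hF : StronglyMeasurable[MeasurableSpace.invariants T] ({x | ‖G x‖ ≤ C}.indicator G) :=
    hGm.indicator hs
  refine ⟨_, hF, fun x => ?_, fun x => ?_, ?_⟩
  · exact congrFun (MeasurableSpace.comp_eq_of_measurable_invariants hF.measurable) x
  · by_cases hx : ‖G x‖ ≤ C
    · rwa [Set.indicator_of_mem (s := {x | ‖G x‖ ≤ C}) hx]
    · rwa [Set.indicator_of_notMem (s := {x | ‖G x‖ ≤ C}) hx, norm_zero]
  · filter_upwards [ae_bdd_norm_condExp_of_ae_bdd_norm
      (m := MeasurableSpace.invariants T) hC] with x hx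
    exact Set.indicator_of_mem (s := {x | ‖G x‖ ≤ C}) hx _

end MeanErgodic

/-- One of `b` and `-b` is a sublinear concave sequence. -/
def IsSignedSublinearConcave (b : ℕ → ℝ) : Prop :=
  IsSublinearConcave b ∨ IsSublinearConcave fun n => -b n

theorem abs_floor_sub_le_one (x : ℝ) : |(⌊x⌋ : ℝ) - x| ≤ 1 := by
  rw [abs_le]
  constructor <;> linarith [Int.floor_le x, Int.lt_floor_add_one x]

theorem abs_ceil_sub_le_one (x : ℝ) : |(⌈x⌉ : ℝ) - x| ≤ 1 := by
  rw [abs_le]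
  constructor <;> linarith [Int.le_ceil x, Int.ceil_lt_add_one x]

namespace IsSignedSublinearConcave

variable {b : ℕ → ℝ}

theorem exists_countBelow_floor_le (hb : IsSignedSublinearConcave b) :
    ∃ C : ℝ, ∀ N, (countBelow (fun j => ⌊b (j + 1)⌋ ≠ ⌊b j⌋) N : ℝ) ≤ C + |b N| := by
  rcases hb with hb | hb
  · exact hb.exists_countBelow_le Int.floor_mono abs_floor_sub_le_one
  · obtain ⟨C, hC⟩ := hb.exists_countBelow_le Int.ceil_mono abs_ceil_sub_le_one
    refine ⟨C, fun N => ?_⟩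
    simpa only [Int.ceil_neg, ne_eq, neg_inj, abs_neg] using hC N

theorem tendsto_abs_atTop (hb : IsSignedSublinearConcave b) :
    Tendsto (fun n => |b n|) atTop atTop := by
  rcases hb with hb | hb
  · exact tendsto_abs_atTop_atTop.comp hb.tendsto_atTop
  · simpa [Function.comp_def] using tendsto_abs_atTop_atTop.comp hb.tendsto_atTop

theorem tendsto_inv (hb : IsSignedSublinearConcave b) :
    Tendsto (fun n => (b n)⁻¹) atTop (𝓝 0) := by
  rw [tendsto_zero_iff_abs_tendsto_zero]
  exact hb.tendsto_abs_atTop.inv_tendsto_atTop.congr fun n => (abs_inv _).symm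

theorem eventually_ne_zero (hb : IsSignedSublinearConcave b) : ∀ᶠ n in atTop, b n ≠ 0 :=
  (hb.tendsto_abs_atTop.eventually_gt_atTop 0).mono fun _ h => abs_pos.1 h

theorem exists_tendsto_zero_norm_average_le (hb : IsSignedSublinearConcave b) {D : ℕ → Prop}
    (hD : Tendsto (fun N => countBelow D N / b N) atTop (𝓝 0)) (𝕜 : Type*) [RCLike 𝕜] :
    ∃ E : ℕ → ℝ, Tendsto E atTop (𝓝 0) ∧ ∀ᶠ N : ℕ in atTop,
      ∀ (g : ℕ → 𝕜) (H : ℤ → 𝕜) (G B : ℝ), (∀ n, ‖g n‖ ≤ G) → (∀ m, ‖H m‖ ≤ B) →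
        (∀ j, ¬ D j → g (j + 1) = g j) →
        ‖(N : 𝕜)⁻¹ * ∑ n ∈ Finset.Icc 1 N, g n * (H ⌊b n⌋ - H (⌊b n⌋ + 1))‖ ≤ G * B * E N := by
  rcases hb with hb | hb
  · exact hb.exists_tendsto_zero_norm_average_le Int.floor_mono Int.floor_add_one
      abs_floor_sub_le_one hD 𝕜
  · obtain ⟨E, hE, h⟩ := hb.exists_tendsto_zero_norm_average_le Int.ceil_mono Int.ceil_add_one
      abs_ceil_sub_le_one (D := D) (by simpa [div_neg] using hD.neg) 𝕜
    refine ⟨E, hE, h.mono fun N hN g H G B hg hH hgD => ?_⟩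
    have := hN g (fun m => H (1 - m)) G B hg (fun m => hH _) hgD
    rw [← norm_neg, ← mul_neg, ← Finset.sum_neg_distrib] at this
    refine (congrArg _ (congrArg _ (Finset.sum_congr rfl fun n _ => ?_))).trans_le this
    rw [Int.ceil_neg, ← mul_neg, neg_sub, sub_neg_eq_add, add_comm (1 : ℤ),
      show (1 : ℤ) - (-⌊b n⌋ + 1) = ⌊b n⌋ by ring]

end IsSignedSublinearConcave

theorem countBelow_exists_le {ι : Type*} (U : Finset ι) (D : ι → ℕ → Prop) (N : ℕ) :
    countBelow (fun j => ∃ i ∈ U, D i j) N ≤ ∑ i ∈ U, countBelow (D i) N := by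
  classical
  unfold countBelow
  refine (Finset.card_le_card (t := U.biUnion fun i => (Finset.range N).filter (D i)) ?_).trans
    (Finset.card_biUnion_le.trans (le_of_eq ?_))
  · intro j hj
    simp only [Finset.mem_filter, Finset.mem_biUnion] at hj ⊢
    obtain ⟨h1, i, hi, h2⟩ := hj
    exact ⟨i, hi, h1, h2⟩
  · refine Finset.sum_congr rfl fun i _ => ?_
    congr

theorem tendsto_countBelow_floor_div {ι : Type*} {b : ι → ℕ → ℝ}
    (hb : ∀ i, IsSignedSublinearConcave (b i)) (U : Finset ι) (i : ι)
    (hU : ∀ j ∈ U, Tendsto (fun n => b j n / b i n) atTop (𝓝 0)) :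
    Tendsto (fun N => countBelow (fun n => ∃ j ∈ U, ⌊b j (n + 1)⌋ ≠ ⌊b j n⌋) N / b i N) atTop
      (𝓝 0) := by
  choose C hC using fun j => (hb j).exists_countBelow_floor_le
  have hlim : Tendsto (fun N => ∑ j ∈ U, (C j * |(b i N)⁻¹| + |b j N / b i N|)) atTop (𝓝 0) := by
    have : Tendsto (fun N => ∑ j ∈ U, (C j * |(b i N)⁻¹| + |b j N / b i N|)) atTop
        (𝓝 (∑ j ∈ U, (C j * |(0 : ℝ)| + |(0 : ℝ)|))) :=
      tendsto_finsetSum _ fun j hj => ((hb i).tendsto_inv.abs.const_mul (C j)).add (hU j hj).abs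
    simpa using this
  refine squeeze_zero_norm (fun N => ?_) hlim
  have h1 : (countBelow (fun n => ∃ j ∈ U, ⌊b j (n + 1)⌋ ≠ ⌊b j n⌋) N : ℝ) ≤
      ∑ j ∈ U, (C j + |b j N|) := by
    calc _ ≤ ((∑ j ∈ U, countBelow (fun n => ⌊b j (n + 1)⌋ ≠ ⌊b j n⌋) N : ℕ) : ℝ) := by
          exact_mod_cast countBelow_exists_le U (fun j n => ⌊b j (n + 1)⌋ ≠ ⌊b j n⌋) N
      _ ≤ _ := by
          push_cast
          exact Finset.sum_le_sum fun j _ => hC j N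
  rw [Real.norm_eq_abs, div_eq_mul_inv, abs_mul, Nat.abs_cast]
  calc _ ≤ (∑ j ∈ U, (C j + |b j N|)) * |(b i N)⁻¹| := by gcongr
    _ = _ := by
      rw [Finset.sum_mul]
      refine Finset.sum_congr rfl fun j _ => ?_
      rw [add_mul, div_eq_mul_inv, abs_mul]

/-- Among finitely many sequences of different growth rates there is a fastest one. -/
theorem exists_fastest {ι : Type*} {b : ι → ℕ → ℝ} (hne : ∀ i, ∀ᶠ n in atTop, b i n ≠ 0)
    (hdiff : ∀ i j, i ≠ j → Tendsto (fun n => b i n / b j n) atTop (𝓝 0) ∨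
      Tendsto (fun n => b j n / b i n) atTop (𝓝 0)) {U : Finset ι} (hU : U.Nonempty) :
    ∃ i ∈ U, ∀ j ∈ U, j ≠ i → Tendsto (fun n => b j n / b i n) atTop (𝓝 0) := by
  classical
  induction hU using Finset.Nonempty.cons_induction with
  | singleton i =>
    exact ⟨i, by simp, fun j hj hji => absurd (Finset.mem_singleton.1 hj) hji⟩
  | cons k U hk hU ih =>
    obtain ⟨i, hi, h⟩ := ih
    have hki : k ≠ i := fun h => hk (h ▸ hi)
    rcases hdiff k i hki with h1 | h1
    · refine ⟨i, by simp [hi], fun j hj hji => ?_⟩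
      rcases Finset.mem_cons.1 hj with rfl | hj
      · exact h1
      · exact h j hj hji
    · refine ⟨k, by simp, fun j hj hjk => ?_⟩
      have hj := (Finset.mem_cons.1 hj).resolve_left hjk
      by_cases hji : j = i
      · rwa [hji]
      · have := (h j hj hji).mul h1
        rw [zero_mul] at this
        refine this.congr' ?_
        filter_upwards [hne i] with n hn
        exact div_mul_div_cancel₀ hn

theorem HaveDifferentGrowthRates.tendsto_or {ℓ : ℕ} {a : Fin ℓ → ℝ → ℝ}
    (h : HaveDifferentGrowthRates a) {i j : Fin ℓ} (hij : i ≠ j) :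
    Tendsto (fun n : ℕ => a i n / a j n) atTop (𝓝 0) ∨
      Tendsto (fun n : ℕ => a j n / a i n) atTop (𝓝 0) := by
  have hinv : ∀ t, (a i t / a j t)⁻¹ = a j t / a i t := fun t => inv_div _ _
  rcases h i j hij with h | h | h
  · exact .inl (h.comp tendsto_natCast_atTop_atTop)
  · exact .inr (by
      simpa [Function.comp_def, hinv] using
        h.inv_tendsto_atTop.comp tendsto_natCast_atTop_atTop)
  · exact .inr (by
      simpa [Function.comp_def, hinv] using
        h.inv_tendsto_atBot.comp tendsto_natCast_atTop_atTop)

theorem comp_zpow_eq_of_comp_eq {X β : Type*} {T : Equiv.Perm X} {F : X → β}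
    (hF : ∀ x, F (T x) = F x) (k : ℤ) (x : X) : F ((T ^ k) x) = F x := by
  induction k generalizing x with
  | zero => simp
  | succ n ih => rw [zpow_add_one, Equiv.Perm.mul_apply, ih, hF]
  | pred n ih =>
    rw [zpow_sub_one, Equiv.Perm.mul_apply, ih, ← hF, ← Equiv.Perm.mul_apply, mul_inv_cancel, Equiv.Perm.one_apply]

section Averages

variable {X : Type*} [MeasurableSpace X] {μ : Measure X} {𝕜 : Type*} [RCLike 𝕜]

theorem measurePreserving_zpow {T : X ≃ᵐ X} (hT : MeasurePreserving T μ μ) (k : ℤ) :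
    MeasurePreserving (fun x => (T.toEquiv ^ k : Equiv.Perm X) x) μ μ := by
  have hpow : ∀ (S : X ≃ᵐ X) (n : ℕ), MeasurePreserving S μ μ →
      MeasurePreserving (fun x => (S.toEquiv ^ n : Equiv.Perm X) x) μ μ := by
    intro S n hS
    have : (fun x => (S.toEquiv ^ n : Equiv.Perm X) x) = S^[n] := Equiv.Perm.coe_pow _ _
    rw [this]
    exact hS.iterate n
  obtain ⟨n, rfl | rfl⟩ := k.eq_nat_or_neg
  · simpa using hpow T n hT
  · have : (T.toEquiv ^ (-(n : ℤ)) : Equiv.Perm X) = T.symm.toEquiv ^ n := by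
      rw [zpow_neg, zpow_natCast, ← inv_pow]
      rfl
    rw [this]
    exact hpow T.symm n (hT.symm T)

theorem exists_bounded_version {f : X → 𝕜} (hf : MemLp f ∞ μ) :
    ∃ f' : X → 𝕜, StronglyMeasurable f' ∧ f =ᵐ[μ] f' ∧ ∃ C, 0 ≤ C ∧ ∀ x, ‖f' x‖ ≤ C := by
  obtain ⟨C, hC⟩ : ∃ C, ∀ᵐ x ∂μ, ‖f x‖ ≤ C := ⟨_, ae_le_lpNorm_exponent_top hf⟩
  set w := hf.1.mk f
  have hw : StronglyMeasurable w := hf.1.stronglyMeasurable_mk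
  have hs : MeasurableSet {x | ‖w x‖ ≤ max C 0} :=
    hw.norm.measurableSet_le stronglyMeasurable_const
  refine ⟨{x | ‖w x‖ ≤ max C 0}.indicator w, hw.indicator hs, ?_, max C 0, le_max_right _ _,
    fun x => ?_⟩
  · filter_upwards [hf.1.ae_eq_mk, hC] with x h1 h2
    rw [Set.indicator_of_mem (s := {x | ‖w x‖ ≤ max C 0})]
    · exact h1
    · exact (h1 ▸ h2.trans (le_max_left _ _) : ‖w x‖ ≤ _)
  · by_cases hx : ‖w x‖ ≤ max C 0
    · rwa [Set.indicator_of_mem (s := {x | ‖w x‖ ≤ max C 0}) hx]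
    · rw [Set.indicator_of_notMem (s := {x | ‖w x‖ ≤ max C 0}) hx, norm_zero]
      exact le_max_right _ _

theorem eLpNorm_average_le {F : ℕ → X → 𝕜} (hF : ∀ n, AEStronglyMeasurable (F n) μ) {c : ℝ≥0∞}
    (h : ∀ n, eLpNorm (F n) 2 μ ≤ c) (N : ℕ) :
    eLpNorm (fun x => (N : 𝕜)⁻¹ * ∑ n ∈ Finset.Icc 1 N, F n x) 2 μ ≤ c := by
  have h1 : (fun x => (N : 𝕜)⁻¹ * ∑ n ∈ Finset.Icc 1 N, F n x) =
      (N : 𝕜)⁻¹ • ∑ n ∈ Finset.Icc 1 N, F n := by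
    ext x
    simp
  rw [h1, eLpNorm_const_smul]
  rcases Nat.eq_zero_or_pos N with rfl | hN
  · simp
  have h2 : eLpNorm (∑ n ∈ Finset.Icc 1 N, F n) 2 μ ≤ N * c := by
    refine (eLpNorm_sum_le (fun n _ => hF n) one_le_two).trans ?_
    refine (Finset.sum_le_card_nsmul _ _ c fun n _ => h n).trans (le_of_eq ?_)
    simp
  have h3 : ‖(N : 𝕜)⁻¹‖ₑ = (N : ℝ≥0∞)⁻¹ := by
    rw [enorm_inv (Nat.cast_ne_zero.2 hN.ne'), ← ofReal_norm, RCLike.norm_natCast,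
      ENNReal.ofReal_natCast]
  rw [h3]
  calc _ ≤ (N : ℝ≥0∞)⁻¹ * (N * c) := by gcongr
    _ = c := by
      rw [← mul_assoc, ENNReal.inv_mul_cancel (by exact_mod_cast hN.ne') (by simp), one_mul]

variable [IsProbabilityMeasure μ]

theorem eLpNorm_le_ofReal_of_norm_le {f : X → 𝕜} {C : ℝ} (h : ∀ x, ‖f x‖ ≤ C) :
    eLpNorm f 2 μ ≤ ENNReal.ofReal C := by
  simpa using eLpNorm_le_of_ae_bound (p := 2) (μ := μ) (.of_forall h)

/-- Averages along the fastest sequence of a function with vanishing conditional expectation tend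
to zero in `L²`, with weights that change rarely. -/
theorem tendsto_eLpNorm_weighted_average_zero {T : X ≃ᵐ X} (hT : MeasurePreserving T μ μ)
    {φ : X → 𝕜} (hφ : StronglyMeasurable φ) {C : ℝ} (hC : ∀ x, ‖φ x‖ ≤ C)
    (h0 : μ[φ | MeasurableSpace.invariants T] =ᵐ[μ] 0) {b : ℕ → ℝ}
    (hb : IsSignedSublinearConcave b) {D : ℕ → Prop}
    (hD : Tendsto (fun N => countBelow D N / b N) atTop (𝓝 0)) {g : ℕ → X → 𝕜}
    (hg : ∀ n, StronglyMeasurable (g n)) {G : ℝ} (hgG : ∀ n x, ‖g n x‖ ≤ G)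
    (hgD : ∀ j, ¬ D j → g (j + 1) = g j) :
    Tendsto (fun N : ℕ => eLpNorm (fun x => (N : 𝕜)⁻¹ *
      ∑ n ∈ Finset.Icc 1 N, g n x * φ ((T.toEquiv ^ ⌊b n⌋ : Equiv.Perm X) x)) 2 μ) atTop (𝓝 0) := by
  obtain ⟨x₀⟩ := μ.nonempty_of_neZero
  have hG : 0 ≤ G := (norm_nonneg _).trans (hgG 0 x₀)
  rw [ENNReal.tendsto_nhds_zero]
  intro ε hε
  set δ : ℝ≥0∞ := ε / 2 / ENNReal.ofReal (G + 1) with hδ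
  have hδ0 : 0 < δ := ENNReal.div_pos (ENNReal.half_pos hε.ne').ne' ENNReal.ofReal_ne_top
  have hδε : ENNReal.ofReal G * δ ≤ ε / 2 :=
    (mul_le_mul_left (ENNReal.ofReal_le_ofReal (by linarith : G ≤ G + 1)) δ).trans
      ENNReal.mul_div_le
  obtain ⟨h, hh, ⟨B, hB⟩, hle⟩ := exists_coboundary_approx hT hφ hC h0 hδ0
  obtain ⟨E, hE, hsum⟩ := hb.exists_tendsto_zero_norm_average_le hD 𝕜
  have hlim : Tendsto (fun N => ENNReal.ofReal (G * B * E N)) atTop (𝓝 0) := by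
    simpa using ENNReal.tendsto_ofReal (hE.const_mul (G * B))
  set r : X → 𝕜 := fun x => φ x - (h x - h (T x)) with hr
  have hrm : StronglyMeasurable r := hφ.sub (hh.sub (hh.comp_measurable T.measurable))
  have hmp := fun n : ℕ => measurePreserving_zpow hT ⌊b n⌋
  filter_upwards [hsum, hlim.eventually_le_const (ENNReal.half_pos hε.ne')] with N hN1 hN2
  have hdecomp : (fun x => (N : 𝕜)⁻¹ *
      ∑ n ∈ Finset.Icc 1 N, g n x * φ ((T.toEquiv ^ ⌊b n⌋ : Equiv.Perm X) x)) =
      (fun x => (N : 𝕜)⁻¹ * ∑ n ∈ Finset.Icc 1 N, g n x *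
        (h ((T.toEquiv ^ ⌊b n⌋ : Equiv.Perm X) x) -
          h ((T.toEquiv ^ (⌊b n⌋ + 1) : Equiv.Perm X) x))) +
      fun x => (N : 𝕜)⁻¹ * ∑ n ∈ Finset.Icc 1 N,
        g n x * r ((T.toEquiv ^ ⌊b n⌋ : Equiv.Perm X) x) := by
    ext x
    rw [Pi.add_apply, ← mul_add, ← Finset.sum_add_distrib]
    congr 1
    refine Finset.sum_congr rfl fun n _ => ?_
    rw [← mul_add, hr, add_comm _ (1 : ℤ), zpow_one_add]
    simp only [Equiv.Perm.mul_apply, MeasurableEquiv.coe_toEquiv]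
    ring
  have hterm : ∀ {ψ : X → 𝕜}, StronglyMeasurable ψ → ∀ k : ℤ,
      StronglyMeasurable fun x => ψ ((T.toEquiv ^ k : Equiv.Perm X) x) := fun hψ k =>
    hψ.comp_measurable (measurePreserving_zpow hT k).measurable
  rw [hdecomp]
  refine (eLpNorm_add_le ?_ ?_ one_le_two).trans ((add_le_add ?_ ?_).trans_eq (ENNReal.add_halves ε))
  · exact ((Finset.stronglyMeasurable_fun_sum _ fun n _ =>
      (hg n).mul ((hterm hh _).sub (hterm hh _))).const_mul _).aestronglyMeasurable
  · exact ((Finset.stronglyMeasurable_fun_sum _ fun n _ =>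
      (hg n).mul (hterm hrm _)).const_mul _).aestronglyMeasurable
  · refine le_trans (eLpNorm_le_ofReal_of_norm_le fun x => ?_) hN2
    exact hN1 (fun n => g n x) (fun k => h ((T.toEquiv ^ k : Equiv.Perm X) x)) G B
      (fun n => hgG n x) (fun k => hB _) fun j hj => congrFun (hgD j hj) x
  · refine le_trans (eLpNorm_average_le (fun n =>
      ((hg n).mul (hterm hrm _)).aestronglyMeasurable) (fun n => ?_) N) hδε
    refine (eLpNorm_le_mul_eLpNorm_of_ae_le_mul
      (g := fun x => r ((T.toEquiv ^ ⌊b n⌋ : Equiv.Perm X) x)) (c := G) (.of_forall fun x => ?_)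
      2).trans ?_
    · rw [Pi.mul_apply, norm_mul]
      exact mul_le_mul_of_nonneg_right (hgG n x) (norm_nonneg _)
    · gcongr
      have := eLpNorm_comp_measurePreserving (p := 2) hrm.aestronglyMeasurable (hmp n)
      exact this.trans_le hle

theorem tendsto_eLpNorm_average_prod_sub_prod {ι : Type*} {b : ι → ℕ → ℝ}
    (hb : ∀ i, IsSignedSublinearConcave (b i))
    (hdiff : ∀ i j, i ≠ j → Tendsto (fun n => b i n / b j n) atTop (𝓝 0) ∨
      Tendsto (fun n => b j n / b i n) atTop (𝓝 0))
    {T : ι → X ≃ᵐ X} (hT : ∀ i, MeasurePreserving (T i) μ μ) {f F : ι → X → 𝕜}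
    (hf : ∀ i, StronglyMeasurable (f i)) {C : ι → ℝ} (hfC : ∀ i x, ‖f i x‖ ≤ C i)
    (hF : ∀ i, StronglyMeasurable[MeasurableSpace.invariants (T i)] (F i))
    (hFT : ∀ i x, F i (T i x) = F i x) (hFC : ∀ i x, ‖F i x‖ ≤ C i)
    (hcond : ∀ i, F i =ᵐ[μ] μ[f i | MeasurableSpace.invariants (T i)]) (U : Finset ι) :
    Tendsto (fun N : ℕ => eLpNorm (fun x => (N : 𝕜)⁻¹ * ∑ n ∈ Finset.Icc 1 N,
      ∏ i ∈ U, f i (((T i).toEquiv ^ ⌊b i n⌋ : Equiv.Perm X) x) - ∏ i ∈ U, F i x) 2 μ) atTop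
      (𝓝 0) := by
  classical
  obtain ⟨x₀⟩ := μ.nonempty_of_neZero
  have hFm : ∀ i, StronglyMeasurable (F i) := fun i =>
    (hF i).mono (MeasurableSpace.invariants_le _)
  induction U using Finset.strongInduction with
  | H U ih =>
    rcases U.eq_empty_or_nonempty with rfl | hU
    · refine tendsto_const_nhds.congr' ?_
      filter_upwards [eventually_ne_atTop 0] with N hN
      have : (N : 𝕜) ≠ 0 := Nat.cast_ne_zero.2 hN
      simp [this]
    obtain ⟨i, hi, hfast⟩ := exists_fastest (fun i => (hb i).eventually_ne_zero) hdiff hU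
    set V := U.erase i with hV
    have hprod : ∀ p : ι → 𝕜, ∏ j ∈ U, p j = (∏ j ∈ V, p j) * p i := fun p =>
      (Finset.prod_erase_mul U p hi).symm
    have hterm : ∀ j (k : ℤ), StronglyMeasurable fun x =>
        f j (((T j).toEquiv ^ k : Equiv.Perm X) x) := fun j k =>
      (hf j).comp_measurable (measurePreserving_zpow (hT j) k).measurable
    set g : ℕ → X → 𝕜 := fun n x =>
      ∏ j ∈ V, f j (((T j).toEquiv ^ ⌊b j n⌋ : Equiv.Perm X) x) with hg
    have hgm : ∀ n, StronglyMeasurable (g n) := fun n =>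
      Finset.stronglyMeasurable_fun_prod _ fun j _ => hterm j _
    have hint : ∀ {ψ : X → 𝕜} {c : ℝ}, StronglyMeasurable ψ → (∀ x, ‖ψ x‖ ≤ c) →
        Integrable ψ μ := fun hψ hc => .of_bound hψ.aestronglyMeasurable _ (.of_forall hc)
    have hcond0 : μ[f i - F i | MeasurableSpace.invariants (T i)] =ᵐ[μ] 0 := by
      have hm := MeasurableSpace.invariants_le (T i)
      refine (condExp_sub (hint (hf i) (hfC i)) (hint (hFm i) (hFC i)) _).trans ?_
      rw [condExp_of_stronglyMeasurable hm (hF i) (hint (hFm i) (hFC i))]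
      filter_upwards [hcond i] with x hx
      simp [hx]
    have hmain := tendsto_eLpNorm_weighted_average_zero (hT i) ((hf i).sub (hFm i))
      (C := C i + C i) (fun x => (norm_sub_le _ _).trans (add_le_add (hfC i x) (hFC i x))) hcond0
      (hb i) (tendsto_countBelow_floor_div hb V i fun j hj =>
        hfast j (Finset.mem_of_mem_erase hj) (Finset.ne_of_mem_erase hj)) hgm
      (G := ∏ j ∈ V, C j) (fun n x => by
        rw [hg, norm_prod]
        exact Finset.prod_le_prod (fun _ _ => norm_nonneg _) fun j _ => hfC j _) (by
        intro n hn
        push Not at hn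
        ext x
        refine Finset.prod_congr rfl fun j hj => ?_
        rw [← hn j hj])
    have hrest := ENNReal.Tendsto.const_mul (a := ENNReal.ofReal (C i))
      (ih V (Finset.erase_ssubset hi)) (.inr ENNReal.ofReal_ne_top)
    rw [mul_zero] at hrest
    have hadd := hmain.add hrest
    rw [add_zero] at hadd
    refine tendsto_of_tendsto_of_tendsto_of_le_of_le tendsto_const_nhds hadd
      (fun _ => zero_le) fun N => ?_
    have hdecomp : (fun x => (N : 𝕜)⁻¹ * ∑ n ∈ Finset.Icc 1 N,
        ∏ j ∈ U, f j (((T j).toEquiv ^ ⌊b j n⌋ : Equiv.Perm X) x) - ∏ j ∈ U, F j x) =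
        (fun x => (N : 𝕜)⁻¹ * ∑ n ∈ Finset.Icc 1 N,
          g n x * (f i - F i) (((T i).toEquiv ^ ⌊b i n⌋ : Equiv.Perm X) x)) +
        fun x => F i x * ((N : 𝕜)⁻¹ * ∑ n ∈ Finset.Icc 1 N, g n x - ∏ j ∈ V, F j x) := by
      ext x
      simp only [Pi.add_apply, Pi.sub_apply, hprod,
        comp_zpow_eq_of_comp_eq (T := (T i).toEquiv) (hFT i), mul_sub, Finset.sum_sub_distrib,
        ← Finset.sum_mul]
      simp only [hg]
      ring
    rw [hdecomp]
    refine (eLpNorm_add_le ?_ ?_ one_le_two).trans (add_le_add le_rfl ?_)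
    · exact ((Finset.stronglyMeasurable_fun_sum _ fun n _ => (hgm n).mul
        (((hf i).sub (hFm i)).comp_measurable
          (measurePreserving_zpow (hT i) _).measurable)).const_mul _).aestronglyMeasurable
    · exact ((hFm i).mul (((Finset.stronglyMeasurable_fun_sum _ fun n _ => hgm n).const_mul _).sub
        (Finset.stronglyMeasurable_fun_prod _ fun j _ => hFm j))).aestronglyMeasurable
    · refine eLpNorm_le_mul_eLpNorm_of_ae_le_mul (.of_forall fun x => ?_) 2
      rw [norm_mul]
      exact mul_le_mul_of_nonneg_right (hFC i x) (norm_nonneg _)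

end Averages

theorem theoremT {ℓ : ℕ} (a : Fin ℓ → ℝ → ℝ)
    (ha_le : ∀ i, IsLogExp (a i)) (ha_G : ∀ i, IsFractionalGrowth (a i))
    (ha_diff : HaveDifferentGrowthRates a)
    (ha_sub : ∀ i, GrowsSlower (a i) (fun t => t))
    {X : Type*} [MeasurableSpace X] (μ : Measure X) [IsProbabilityMeasure μ]
    (T : Fin ℓ → X ≃ᵐ X) (hT : ∀ i, MeasurePreserving (T i) μ μ)
    {𝕜 : Type*} [RCLike 𝕜] (f : Fin ℓ → X → 𝕜) (hf : ∀ i, MemLp (f i) ∞ μ) :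
    Tendsto
      (fun N : ℕ => eLpNorm
        (fun x => ((N : 𝕜)⁻¹ *
            ∑ n ∈ Finset.Icc 1 N, ∏ i, f i (((T i).toEquiv ^ ⌊a i (n : ℝ)⌋ : Equiv.Perm X) x))
          - (∏ i, (μ[f i | MeasurableSpace.invariants (T i)]) x)) 2 μ)
      atTop (𝓝 0) := by
  choose f' hf'm hff' C hC0 hC using fun i => exists_bounded_version (hf i)
  choose F hF hFT hFC hcond using fun i =>
    exists_invariant_version_condExp (μ := μ) (T i) (hC0 i) (.of_forall (hC i))
  refine (tendsto_eLpNorm_average_prod_sub_prod (b := fun i n => a i n)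
    (fun i => (ha_le i).isSublinearConcave (ha_G i) (ha_sub i))
    (fun i j hij => ha_diff.tendsto_or hij) hT hf'm hC hF hFT hFC hcond Finset.univ).congr
    fun N => eLpNorm_congr_ae ?_
  have h1 : ∀ᵐ x ∂μ, ∀ (i : Fin ℓ) (n : ℕ),
      f i (((T i).toEquiv ^ ⌊a i (n : ℝ)⌋ : Equiv.Perm X) x) =
        f' i (((T i).toEquiv ^ ⌊a i (n : ℝ)⌋ : Equiv.Perm X) x) := by
    rw [ae_all_iff]
    intro i
    rw [ae_all_iff]
    intro n
    exact (measurePreserving_zpow (hT i) _).quasiMeasurePreserving.ae (hff' i)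
  have h2 : ∀ᵐ x ∂μ, ∀ i, F i x = (μ[f i | MeasurableSpace.invariants (T i)]) x := by
    rw [ae_all_iff]
    exact fun i => (hcond i).trans (condExp_congr_ae (hff' i).symm)
  filter_upwards [h1, h2] with x h1 h2
  simp only [h1, h2]
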